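/- Let $\mathcal G\rightrightarrows M$ be a Lie groupoid (smooth, finite-dimensional, real, $M$ Hausdorff) with source $\mathsf s$ and target $\mathsf t$, arrows $g,h$ being composable, with product $g\circ h$, when $\mathsf s(g)=\mathsf t(h)$; view $M\subset\mathcal G$ as the units. Let $E=\mathrm{Lie}(\mathcal G)=T\mathcal G|_M/TM$. For a smooth section $X$ of $E$ let $X^L$ (resp. $X^R$) be the left-invariant (resp. right-invariant) vector field on $\mathcal G$, tangent to the fibres of $\mathsf t$ (resp. $\mathsf s$), which represents $X$ along $M$; the bracket $[X,Y]$ of sections of $E$ is the class of $[X^L,Y^L]|_M$. Let $F:\mathcal G\to\mathbb R$ be a contrast function, i.e. $F$ is smooth, $F|_M=0$ and $dF|_M=0$. Let $g^F$ be the symmetric $2$-form on $E$ given by $g^F(X,Y)=X^LY^LF|_M$, let $K^F=\{e\in E : g^F(e,\cdot)=0\}$, and let $\mathcal K^F$ be the space of smooth sections of $E$ with values in $K^F$. Assume that $F$ is a Koszul contrast function, i.e. $g^F:E\to E^*$ has constant rank and $$X^LY^LZ^RF|_M=0,\qquad X^RY^RZ^LF|_M=0$$ for all smooth sections $X,Y$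 of $E$ and all $Z\in\mathcal K^F$ (the second condition is the same as $X^LY^LZ^RF^*|_M=0$ with $F^*(g)=F(g^{-1})$). Then $[\mathcal K^F,\mathcal K^F]\subset\mathcal K^F$, and $K^F$ is a Lie subalgebroid of $\mathrm{Lie}(\mathcal G)$, i.e. a smooth vector subbundle of $E$ whose smooth sections are closed under the bracket. -/

import Mathlib

open scoped Manifold ContDiff Topology

noncomputable section

/-- A (smooth, finite-dimensional, real) Lie groupoid `G ⇉ M`, where `M` and `G` are manifolds
modelled on `EM` and `EG`. Arrows `g`, `h` are composable when `src g = tgt h`, and then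
`mul g h` is `g ∘ h`; the values of `mul` at other pairs are irrelevant. Smoothness of the
multiplication on the embedded submanifold of composable pairs is smoothness within that set. -/
structure LieGroupoid (EM EG M G : Type*)
    [NormedAddCommGroup EM] [NormedSpace ℝ EM] [NormedAddCommGroup EG] [NormedSpace ℝ EG]
    [TopologicalSpace M] [ChartedSpace EM M] [TopologicalSpace G] [ChartedSpace EG G] where
  src : G → M
  tgt : G → M
  unit : M → G
  mul : G → G → G
  inv : G → G
  isSubmersion_src : Manifold.IsSubmersion 𝓘(ℝ, EG) 𝓘(ℝ, EM) ∞ src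
  isSubmersion_tgt : Manifold.IsSubmersion 𝓘(ℝ, EG) 𝓘(ℝ, EM) ∞ tgt
  isSmoothEmbedding_unit : Manifold.IsSmoothEmbedding 𝓘(ℝ, EM) 𝓘(ℝ, EG) ∞ unit
  contMDiffOn_mul : ContMDiffOn (𝓘(ℝ, EG).prod 𝓘(ℝ, EG)) 𝓘(ℝ, EG) ∞
    (fun p : G × G => mul p.1 p.2) {p : G × G | src p.1 = tgt p.2}
  contMDiff_inv : ContMDiff 𝓘(ℝ, EG) 𝓘(ℝ, EG) ∞ inv
  src_unit : ∀ x, src (unit x) = x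
  tgt_unit : ∀ x, tgt (unit x) = x
  src_mul : ∀ g h, src g = tgt h → src (mul g h) = src h
  tgt_mul : ∀ g h, src g = tgt h → tgt (mul g h) = tgt g
  mul_assoc : ∀ g h k, src g = tgt h → src h = tgt k → mul (mul g h) k = mul g (mul h k)
  unit_mul : ∀ g, mul (unit (tgt g)) g = g
  mul_unit : ∀ g, mul g (unit (src g)) = g
  src_inv : ∀ g, src (inv g) = tgt g
  tgt_inv : ∀ g, tgt (inv g) = src g
  mul_inv : ∀ g, mul g (inv g) = unit (tgt g)
  inv_mul : ∀ g, mul (inv g) g = unit (src g)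

namespace LieGroupoid

variable {EM EG M G : Type*}
  [NormedAddCommGroup EM] [NormedSpace ℝ EM] [NormedAddCommGroup EG] [NormedSpace ℝ EG]
  [TopologicalSpace M] [ChartedSpace EM M] [TopologicalSpace G] [ChartedSpace EG G]

section Derivatives

/-- The function `V φ` : the derivative of a function `φ` on `G` along a vector field `V`. -/
def lieD (V : ∀ g : G, TangentSpace 𝓘(ℝ, EG) g) (φ : G → ℝ) : G → ℝ :=
  fun g => mfderiv 𝓘(ℝ, EG) 𝓘(ℝ, ℝ) φ g (V g)

/-- The second derivative at `p` of a function `F` on `G`, read in the preferred chart at `p`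
(the chart through which `TangentSpace 𝓘(ℝ, EG) p` is identified with `EG`). At a critical point
of `F` it does not depend on charts. -/
def hess (F : G → ℝ) (p : G) :
    TangentSpace 𝓘(ℝ, EG) p →ₗ[ℝ] TangentSpace 𝓘(ℝ, EG) p →ₗ[ℝ] ℝ :=
  (ContinuousLinearMap.coeLM ℝ : (EG →L[ℝ] ℝ) →ₗ[ℝ] (EG →ₗ[ℝ] ℝ)).comp
    (fderiv ℝ (fderiv ℝ (F ∘ (extChartAt 𝓘(ℝ, EG) p).symm))
      (extChartAt 𝓘(ℝ, EG) p p) : EG →ₗ[ℝ] (EG →L[ℝ] ℝ))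

theorem contDiffAt_chart {F : G → ℝ} (hF : ContMDiff 𝓘(ℝ, EG) 𝓘(ℝ, ℝ) ∞ F) (p : G) :
    ContDiffAt ℝ ∞ (F ∘ (extChartAt 𝓘(ℝ, EG) p).symm) (extChartAt 𝓘(ℝ, EG) p p) := by
  have h := (contMDiffAt_iff.1 (hF p)).2
  simpa [Function.comp_def, contDiffWithinAt_univ] using! h

end Derivatives

variable (𝒢 : LieGroupoid EM EG M G)

/-! ### The vector bundle `Lie(G) = TG|_M / TM` -/

/-- The differentials at `x` of the unit embedding, and of source and target at the unit of `x`. -/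
def dUnit (x : M) : TangentSpace 𝓘(ℝ, EM) x →ₗ[ℝ] TangentSpace 𝓘(ℝ, EG) (𝒢.unit x) :=
  (mfderiv 𝓘(ℝ, EM) 𝓘(ℝ, EG) 𝒢.unit x).toLinearMap

def dSrc (x : M) : TangentSpace 𝓘(ℝ, EG) (𝒢.unit x) →ₗ[ℝ] TangentSpace 𝓘(ℝ, EM) x :=
  (mfderiv 𝓘(ℝ, EG) 𝓘(ℝ, EM) 𝒢.src (𝒢.unit x)).toLinearMap

def dTgt (x : M) : TangentSpace 𝓘(ℝ, EG) (𝒢.unit x) →ₗ[ℝ] TangentSpace 𝓘(ℝ, EM) x :=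
  (mfderiv 𝓘(ℝ, EG) 𝓘(ℝ, EM) 𝒢.tgt (𝒢.unit x)).toLinearMap

theorem dSrc_dUnit (x : M) (v : TangentSpace 𝓘(ℝ, EM) x) : 𝒢.dSrc x (𝒢.dUnit x v) = v := by
  have hs : MDifferentiableAt 𝓘(ℝ, EG) 𝓘(ℝ, EM) 𝒢.src (𝒢.unit x) :=
    (𝒢.isSubmersion_src.contMDiff (𝒢.unit x)).mdifferentiableAt (by simp)
  have hu : MDifferentiableAt 𝓘(ℝ, EM) 𝓘(ℝ, EG) 𝒢.unit x :=
    (𝒢.isSmoothEmbedding_unit.contMDiff x).mdifferentiableAt (by simp)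
  have h := mfderiv_comp_apply x hs hu v
  have hc : 𝒢.src ∘ 𝒢.unit = id := funext 𝒢.src_unit
  rw [hc, mfderiv_id] at h
  exact h.symm

theorem dTgt_dUnit (x : M) (v : TangentSpace 𝓘(ℝ, EM) x) : 𝒢.dTgt x (𝒢.dUnit x v) = v := by
  have hs : MDifferentiableAt 𝓘(ℝ, EG) 𝓘(ℝ, EM) 𝒢.tgt (𝒢.unit x) :=
    (𝒢.isSubmersion_tgt.contMDiff (𝒢.unit x)).mdifferentiableAt (by simp)
  have hu : MDifferentiableAt 𝓘(ℝ, EM) 𝓘(ℝ, EG) 𝒢.unit x :=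
    (𝒢.isSmoothEmbedding_unit.contMDiff x).mdifferentiableAt (by simp)
  have h := mfderiv_comp_apply x hs hu v
  have hc : 𝒢.tgt ∘ 𝒢.unit = id := funext 𝒢.tgt_unit
  rw [hc, mfderiv_id] at h
  exact h.symm

/-- The fibre of `Lie(G)` over `x`: the normal space `T_x G / T_x M` at the unit of `x`. -/
abbrev Fiber (x : M) : Type _ :=
  TangentSpace 𝓘(ℝ, EG) (𝒢.unit x) ⧸ LinearMap.range (𝒢.dUnit x)

/-- The class in `Lie(G)` of a vector tangent to `G` at a unit. -/
def toFiber (x : M) : TangentSpace 𝓘(ℝ, EG) (𝒢.unit x) →ₗ[ℝ] 𝒢.Fiber x :=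
  (LinearMap.range (𝒢.dUnit x)).mkQ

/-- The representative in `Ker T tgt` of an element of `Lie(G)`. -/
def leftRep (x : M) : 𝒢.Fiber x →ₗ[ℝ] TangentSpace 𝓘(ℝ, EG) (𝒢.unit x) :=
  (LinearMap.range (𝒢.dUnit x)).liftQ (LinearMap.id - (𝒢.dUnit x).comp (𝒢.dTgt x)) (by
    rintro _ ⟨v, rfl⟩
    simp [𝒢.dTgt_dUnit x v])

/-- The representative in `Ker T src` of an element of `Lie(G)`. -/
def rightRep (x : M) : 𝒢.Fiber x →ₗ[ℝ] TangentSpace 𝓘(ℝ, EG) (𝒢.unit x) :=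
  (LinearMap.range (𝒢.dUnit x)).liftQ (LinearMap.id - (𝒢.dUnit x).comp (𝒢.dSrc x)) (by
    rintro _ ⟨v, rfl⟩
    simp [𝒢.dSrc_dUnit x v])

section Manifolds

variable [IsManifold 𝓘(ℝ, EG) ∞ G]

/-- `X` is smooth on `U` as a section of the quotient bundle `TG|_M / TM`: it is represented on `U`
by a smooth section of `TG|_M`. -/
def IsSmoothOn (X : ∀ x, 𝒢.Fiber x) (U : Set M) : Prop :=
  ∃ V : ∀ x, TangentSpace 𝓘(ℝ, EG) (𝒢.unit x),
    ContMDiffOn 𝓘(ℝ, EM) 𝓘(ℝ, EG).tangent ∞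
      (fun x => (⟨𝒢.unit x, V x⟩ : TangentBundle 𝓘(ℝ, EG) G)) U ∧
    ∀ x ∈ U, 𝒢.toFiber x (V x) = X x

/-- `X ∈ Sec(Lie(G))`. -/
def IsSection (X : ∀ x, 𝒢.Fiber x) : Prop := 𝒢.IsSmoothOn X Set.univ

/-! ### Invariant vector fields and the bracket -/

/-- The left-invariant vector field `X^L`: its value at `g` is the image of the representative of
`X` tangent to the target fibre at the unit of `src g` under the derivative of left translation by
`g`, which is a map from the target fibre over `src g` to `G`. -/
def leftField (X : ∀ x, 𝒢.Fiber x) (g : G) : TangentSpace 𝓘(ℝ, EG) g :=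
  mfderivWithin 𝓘(ℝ, EG) 𝓘(ℝ, EG) (fun h => 𝒢.mul g h) {h | 𝒢.tgt h = 𝒢.src g}
    (𝒢.unit (𝒢.src g)) (𝒢.leftRep (𝒢.src g) (X (𝒢.src g)))

/-- The right-invariant vector field `X^R`: its value at `g` is the image of the representative of
`X` tangent to the source fibre at the unit of `tgt g` under the derivative of right translation
by `g`, which is a map from the source fibre over `tgt g` to `G`. -/
def rightField (X : ∀ x, 𝒢.Fiber x) (g : G) : TangentSpace 𝓘(ℝ, EG) g :=
  mfderivWithin 𝓘(ℝ, EG) 𝓘(ℝ, EG) (fun h => 𝒢.mul h g) {h | 𝒢.src h = 𝒢.tgt g}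
    (𝒢.unit (𝒢.tgt g)) (𝒢.rightRep (𝒢.tgt g) (X (𝒢.tgt g)))

/-- The Lie algebroid bracket `[X, Y]`, represented along `M` by `[X^L, Y^L]`. -/
def bracket (X Y : ∀ x, 𝒢.Fiber x) (x : M) : 𝒢.Fiber x :=
  𝒢.toFiber x
    (VectorField.mlieBracket 𝓘(ℝ, EG) (𝒢.leftField X) (𝒢.leftField Y) (𝒢.unit x))

/-! ### Subbundles and subalgebroids of `Lie(G)` -/

/-- A family of subspaces of the fibres of `Lie(G)` is a (smooth) vector subbundle: it has constant
rank and is spanned, near every point, by a local frame of smooth sections of `Lie(G)`. -/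
def IsSubbundle (K : ∀ x, Submodule ℝ (𝒢.Fiber x)) : Prop :=
  ∃ r : ℕ, ∀ x₀ : M, ∃ U : Set M, IsOpen U ∧ x₀ ∈ U ∧
    ∃ e : Fin r → ∀ x, 𝒢.Fiber x, (∀ i, 𝒢.IsSmoothOn (e i) U) ∧
      ∀ x ∈ U, LinearIndependent ℝ (fun i => e i x) ∧
        Submodule.span ℝ (Set.range fun i => e i x) = K x

/-- `X ∈ Sec(K)`, the sections of `Lie(G)` with values in `K`. -/
def IsSectionOf (K : ∀ x, Submodule ℝ (𝒢.Fiber x)) (X : ∀ x, 𝒢.Fiber x) : Prop :=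
  𝒢.IsSection X ∧ ∀ x, X x ∈ K x

/-- A Lie subalgebroid of `Lie(G)` (over `M`): a vector subbundle whose sections are closed under
the bracket (so that bracket and anchor of `Lie(G)` restrict to it). -/
structure IsLieSubalgebroid (K : ∀ x, Submodule ℝ (𝒢.Fiber x)) : Prop where
  isSubbundle : 𝒢.IsSubbundle K
  bracket_mem : ∀ X Y, 𝒢.IsSectionOf K X → 𝒢.IsSectionOf K Y → 𝒢.IsSectionOf K (𝒢.bracket X Y)

/-! ### Contrast functions -/

/-- A contrast function: smooth, vanishing on `M` together with its differential. -/
structure IsContrast (F : G → ℝ) : Prop where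
  contMDiff : ContMDiff 𝓘(ℝ, EG) 𝓘(ℝ, ℝ) ∞ F
  apply_unit : ∀ x, F (𝒢.unit x) = 0
  mfderiv_unit : ∀ x, mfderiv 𝓘(ℝ, EG) 𝓘(ℝ, ℝ) F (𝒢.unit x) = 0

/-- The symmetric form `g^F` on the fibre of `Lie(G)` over `x`; `metric_eq` below shows that
`g^F(X, Y) = V (W F)|_M` for arbitrary vector fields `V`, `W` on `G` representing `X`, `Y`. -/
def metric (F : G → ℝ) (x : M) : 𝒢.Fiber x →ₗ[ℝ] 𝒢.Fiber x →ₗ[ℝ] ℝ :=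
  (hess F (𝒢.unit x)).compl₁₂ (𝒢.leftRep x) (𝒢.leftRep x)

/-- The kernel `K^F = {e | g^F(e, ·) = 0}`. -/
def kernel (F : G → ℝ) (x : M) : Submodule ℝ (𝒢.Fiber x) :=
  LinearMap.ker (𝒢.metric F x)

/-- A contrast function is regular if `g^F : Lie(G) → Lie(G)^*` has constant rank. -/
structure IsRegular (F : G → ℝ) : Prop extends 𝒢.IsContrast F where
  constant_rank : ∃ r : ℕ, ∀ x, Module.finrank ℝ (LinearMap.range (𝒢.metric F x)) = r

/-- A Koszul contrast function: a regular contrast function with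
`X^L Y^L Z^R F|_M = 0` and `X^R Y^R Z^L F|_M = 0` for all `X, Y ∈ Sec(Lie(G))`, `Z ∈ Sec(K^F)`.
The second function is `-X^L Y^L Z^R F^*|_M` for `F^* = F ∘ inv`. -/
structure IsKoszul (F : G → ℝ) : Prop extends 𝒢.IsRegular F where
  left : ∀ X Y Z, 𝒢.IsSection X → 𝒢.IsSection Y → 𝒢.IsSectionOf (𝒢.kernel F) Z → ∀ x,
    lieD (𝒢.leftField X) (lieD (𝒢.leftField Y) (lieD (𝒢.rightField Z) F)) (𝒢.unit x) = 0
  right : ∀ X Y Z, 𝒢.IsSection X → 𝒢.IsSection Y → 𝒢.IsSectionOf (𝒢.kernel F) Z → ∀ x,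
    lieD (𝒢.rightField X) (lieD (𝒢.rightField Y) (lieD (𝒢.leftField Z) F)) (𝒢.unit x) = 0

/-! ### The form `g^F` through vector fields representing sections -/

theorem mfderiv_eq_chart {F : G → ℝ} (hF : ContMDiff 𝓘(ℝ, EG) 𝓘(ℝ, ℝ) ∞ F) (p : G) :
    ∀ᶠ q in 𝓝 p, ∀ v : TangentSpace 𝓘(ℝ, EG) q, mfderiv 𝓘(ℝ, EG) 𝓘(ℝ, ℝ) F q v =
      fderiv ℝ (F ∘ (extChartAt 𝓘(ℝ, EG) p).symm) (extChartAt 𝓘(ℝ, EG) p q)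
        (mfderiv 𝓘(ℝ, EG) 𝓘(ℝ, EG) (extChartAt 𝓘(ℝ, EG) p) q v) := by
  have h1 : ∀ᶠ z in 𝓝 (extChartAt 𝓘(ℝ, EG) p p),
      ContDiffAt ℝ 1 (F ∘ (extChartAt 𝓘(ℝ, EG) p).symm) z :=
    ((contDiffAt_chart hF p).of_le (by norm_cast)).eventually (by simp)
  filter_upwards [(continuousAt_extChartAt p).eventually h1,
    extChartAt_source_mem_nhds (I := 𝓘(ℝ, EG)) p] with q hq hs v
  have e : F =ᶠ[𝓝 q] (F ∘ (extChartAt 𝓘(ℝ, EG) p).symm) ∘ extChartAt 𝓘(ℝ, EG) p := by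
    filter_upwards [extChartAt_source_mem_nhds' hs] with y hy
    exact congrArg F ((extChartAt 𝓘(ℝ, EG) p).left_inv hy).symm
  have hd := (hq.differentiableAt (by simp)).hasFDerivAt.hasMFDerivAt.comp q
    (mdifferentiableAt_extChartAt (I := 𝓘(ℝ, EG)) (by simpa using hs)).hasMFDerivAt
  exact congrArg (fun L => L v) (hd.congr_of_eventuallyEq e).mfderiv

theorem lieD_lieD {F : G → ℝ} (hF : ContMDiff 𝓘(ℝ, EG) 𝓘(ℝ, ℝ) ∞ F) (p : G)
    (hp : mfderiv 𝓘(ℝ, EG) 𝓘(ℝ, ℝ) F p = 0)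
    (V W : ∀ g : G, TangentSpace 𝓘(ℝ, EG) g)
    (hW : ContMDiff 𝓘(ℝ, EG) 𝓘(ℝ, EG).tangent ∞
      (fun g => (⟨g, W g⟩ : TangentBundle 𝓘(ℝ, EG) G))) :
    lieD V (lieD W F) p = hess F p (V p) (W p) := by
  set f := F ∘ (extChartAt 𝓘(ℝ, EG) p).symm with hf
  set w : G → EG := fun q => mfderiv 𝓘(ℝ, EG) 𝓘(ℝ, EG) (extChartAt 𝓘(ℝ, EG) p) q (W q) with hw
  have hwd : MDifferentiableAt 𝓘(ℝ, EG) 𝓘(ℝ, EG) w p := by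
    have h := ((hW p).mdifferentiableAt (by simp))
    rw [mdifferentiableAt_section] at h
    refine h.congr_of_eventuallyEq ?_
    filter_upwards [(chartAt EG p).open_source.mem_nhds (mem_chart_source EG p)] with q hq
    simp only [hw]
    have h1 := congrArg (fun L => L (W q))
      (TangentBundle.continuousLinearMapAt_trivializationAt (I := 𝓘(ℝ, EG)) hq)
    refine h1.symm.trans ?_
    exact congrFun (Bundle.Trivialization.coe_linearMapAt_of_mem (R := ℝ)
      (trivializationAt EG (TangentSpace 𝓘(ℝ, EG)) p) (by simpa using hq)) (W q)
  have e : lieD W F =ᶠ[𝓝 p] fun q => fderiv ℝ f (extChartAt 𝓘(ℝ, EG) p q) (w q) := by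
    filter_upwards [mfderiv_eq_chart hF p] with q hq
    exact hq _
  have hz : fderiv ℝ f (extChartAt 𝓘(ℝ, EG) p p) = 0 := by
    have := (mfderiv_eq_chart hF p).self_of_nhds
    rw [hp, mfderiv_extChartAt_self] at this
    ext v
    exact (this v).symm
  have hfd : DifferentiableAt ℝ (fderiv ℝ f) (extChartAt 𝓘(ℝ, EG) p p) :=
    ((contDiffAt_chart hF p).fderiv_right (m := 1) (by norm_cast)).differentiableAt (by simp)
  have hb := (isBoundedBilinearMap_apply (𝕜 := ℝ) (E := EG) (F := ℝ)).hasFDerivAt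
    (fderiv ℝ f (extChartAt 𝓘(ℝ, EG) p p), w p)
  have hc := hfd.hasFDerivAt.hasMFDerivAt.comp p
    (mdifferentiableAt_extChartAt (I := 𝓘(ℝ, EG)) (mem_chart_source EG p)).hasMFDerivAt
  have hD := HasMFDerivAt.comp (f := fun q => (fderiv ℝ f (extChartAt 𝓘(ℝ, EG) p q), w q)) p
    hb.hasMFDerivAt ⟨hc.1.prodMk hwd.hasMFDerivAt.1, hc.2.prodMk hwd.hasMFDerivAt.2⟩
  have key := congrArg (fun L => L (V p)) (hD.congr_of_eventuallyEq e).mfderiv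
  refine key.trans ?_
  have hid := mfderiv_extChartAt_self (I := 𝓘(ℝ, EG)) (x := p)
  have hwp : w p = W p := DFunLike.congr_fun hid (W p)
  have hvp : mfderiv 𝓘(ℝ, EG) 𝓘(ℝ, EG) (extChartAt 𝓘(ℝ, EG) p) p (V p) = V p :=
    DFunLike.congr_fun hid (V p)
  change fderiv ℝ f (extChartAt 𝓘(ℝ, EG) p p) _ +
    fderiv ℝ (fderiv ℝ f) (extChartAt 𝓘(ℝ, EG) p p)
      (mfderiv 𝓘(ℝ, EG) 𝓘(ℝ, EG) (extChartAt 𝓘(ℝ, EG) p) p (V p)) (w p) = _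
  rw [hz, hvp, hwp]
  exact zero_add _

theorem hess_symm {F : G → ℝ} (hF : ContMDiff 𝓘(ℝ, EG) 𝓘(ℝ, ℝ) ∞ F) (p : G)
    (v w : TangentSpace 𝓘(ℝ, EG) p) : hess F p v w = hess F p w v :=
  ((contDiffAt_chart hF p).isSymmSndFDerivAt (by simp; norm_cast)).eq v w

theorem hess_dUnit {F : G → ℝ} (hF : 𝒢.IsContrast F) (x : M)
    (a : TangentSpace 𝓘(ℝ, EM) x) : hess F (𝒢.unit x) (𝒢.dUnit x a) = 0 := by
  set p := 𝒢.unit x with hp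
  refine LinearMap.ext fun w => ?_
  set f := F ∘ (extChartAt 𝓘(ℝ, EG) p).symm with hf
  have hu : MDifferentiableAt 𝓘(ℝ, EM) 𝓘(ℝ, EG) 𝒢.unit x :=
    (𝒢.isSmoothEmbedding_unit.contMDiff x).mdifferentiableAt (by simp)
  have hfd : DifferentiableAt ℝ (fderiv ℝ f) (extChartAt 𝓘(ℝ, EG) p p) :=
    ((contDiffAt_chart hF.contMDiff p).fderiv_right (m := 1) (by norm_cast)).differentiableAt
      (by simp)
  have hc := (hfd.hasFDerivAt.hasMFDerivAt.comp p
    (mdifferentiableAt_extChartAt (I := 𝓘(ℝ, EG)) (mem_chart_source EG p)).hasMFDerivAt).comp x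
    hu.hasMFDerivAt
  have e : (fun _ => (0 : EG →L[ℝ] ℝ)) =ᶠ[𝓝 x]
      (fderiv ℝ f ∘ extChartAt 𝓘(ℝ, EG) p) ∘ 𝒢.unit := by
    filter_upwards [hu.continuousAt.eventually (mfderiv_eq_chart hF.contMDiff p),
      hu.continuousAt.eventually (extChartAt_source_mem_nhds (I := 𝓘(ℝ, EG)) p)] with y hy hs
    rw [hF.mfderiv_unit y] at hy
    ext v
    obtain ⟨v', rfl⟩ := (isInvertible_mfderiv_extChartAt (I := 𝓘(ℝ, EG)) hs).surjective v
    exact hy v'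
  have h0 := (hc.congr_of_eventuallyEq e).mfderiv
  rw [mfderiv_const] at h0
  have hid := mfderiv_extChartAt_self (I := 𝓘(ℝ, EG)) (x := p)
  have hvp : mfderiv 𝓘(ℝ, EG) 𝓘(ℝ, EG) (extChartAt 𝓘(ℝ, EG) p) p (𝒢.dUnit x a) = 𝒢.dUnit x a :=
    DFunLike.congr_fun hid _
  have h1 : (0 : EG →L[ℝ] ℝ) w = _ :=
    congrArg (fun L : EG →L[ℝ] ℝ => L w) (DFunLike.congr_fun h0 a)
  have h2 : fderiv ℝ (fderiv ℝ f) (extChartAt 𝓘(ℝ, EG) p p)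
    (mfderiv 𝓘(ℝ, EG) 𝓘(ℝ, EG) (extChartAt 𝓘(ℝ, EG) p) p (𝒢.dUnit x a)) w = 0 := h1.symm
  rw [hvp] at h2
  exact h2

/-- For a contrast function, `g^F(X, Y) = V (W F)|_M` for all vector fields `V`, `W` on `G` which
represent `X`, `Y` along `M`. -/
theorem metric_eq {F : G → ℝ} (hF : 𝒢.IsContrast F)
    (V W : ∀ g : G, TangentSpace 𝓘(ℝ, EG) g)
    (hW : ContMDiff 𝓘(ℝ, EG) 𝓘(ℝ, EG).tangent ∞
      (fun g => (⟨g, W g⟩ : TangentBundle 𝓘(ℝ, EG) G))) (x : M) :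
    𝒢.metric F x (𝒢.toFiber x (V (𝒢.unit x))) (𝒢.toFiber x (W (𝒢.unit x))) =
      lieD V (lieD W F) (𝒢.unit x) := by
  rw [lieD_lieD hF.contMDiff _ (hF.mfderiv_unit x) V W hW]
  have h (v) : 𝒢.leftRep x (𝒢.toFiber x v) = v - 𝒢.dUnit x (𝒢.dTgt x v) := rfl
  have h' (v a) : hess F (𝒢.unit x) v (𝒢.dUnit x a) = 0 := by
    rw [hess_symm hF.contMDiff, 𝒢.hess_dUnit hF, LinearMap.zero_apply]
  simp only [metric, LinearMap.compl₁₂_apply, h, map_sub, h',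
    𝒢.hess_dUnit hF, sub_zero]

end Manifolds

end LieGroupoid

end

noncomputable section

namespace TangentField

open Bundle

variable {EN EM EG EQ N M G Q : Type*}
  [NormedAddCommGroup EN] [NormedSpace ℝ EN] [NormedAddCommGroup EM] [NormedSpace ℝ EM]
  [NormedAddCommGroup EG] [NormedSpace ℝ EG] [NormedAddCommGroup EQ] [NormedSpace ℝ EQ]
  [TopologicalSpace N] [ChartedSpace EN N] [TopologicalSpace M] [ChartedSpace EM M]
  [TopologicalSpace G] [ChartedSpace EG G] [TopologicalSpace Q] [ChartedSpace EQ Q]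

section Over

/-! ### Smooth vector fields along a map -/

variable [IsManifold 𝓘(ℝ, EG) ∞ G]
  {b : N → G} {v w : ∀ x, TangentSpace 𝓘(ℝ, EG) (b x)} {s : Set N} {x : N}

/-! Let X, Y be sections of K^F and Z any section of Lie(G). Since the bracket acts on functions as
a commutator (`lieD_mlieBracket`), along M one has g^F(Z, [X, Y]) = Z^R X^L Y^L F - Z^R Y^L X^L F,
and each term vanishes. Indeed Y^L F is again a contrast function: it is zero on M because dF is,
and its differential there is g^F(·, Y) = 0 (`IsContrast.lieD`). Second derivatives of a contrast
function along M depend only on classes modulo TM, so X^L may be replaced by X^R, and Z^R X^R Y^L F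
vanishes on M by the second Koszul condition; the other term is the same with X and Y exchanged
(`bracket_mem_kernel`).

This calculus needs invariant fields to be smooth (`contMDiff_leftField`), although the product is
smooth only on composable pairs. Local retractions onto the target fibres extend left translations
to open sets without changing their derivatives along the fibres.

For the subbundle property (`isSubbundle_kernel`), g^F becomes a smooth Gram matrix in a local
frame. Its kernel has constant dimension, hence a smooth local basis, obtained by inverting a nearby
isomorphism (`exists_contDiffOn_basis_ker`). -/

/-- A trivialization is fibrewise linear only over its base set; continuity of `b` keeps nearby
points in it, so linear operations on fields can be done in coordinates. -/
theorem eventually_trivializationAt_linear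
    (hb : ContMDiffWithinAt 𝓘(ℝ, EN) 𝓘(ℝ, EG) ∞ b s x) :
    ∀ᶠ y in 𝓝[s] x, IsLinearMap ℝ fun u : TangentSpace 𝓘(ℝ, EG) (b y) =>
      (trivializationAt EG (TangentSpace 𝓘(ℝ, EG)) (b x) ⟨b y, u⟩).2 := by
  have h := hb.continuousWithinAt.eventually
    ((trivializationAt EG (TangentSpace 𝓘(ℝ, EG)) (b x)).open_baseSet.mem_nhds
      (FiberBundle.mem_baseSet_trivializationAt' (b x)))
  filter_upwards [h] with y hy
  exact (trivializationAt EG (TangentSpace 𝓘(ℝ, EG)) (b x)).linear ℝ hy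

theorem contMDiffWithinAt_add
    (hv : ContMDiffWithinAt 𝓘(ℝ, EN) 𝓘(ℝ, EG).tangent ∞
      (fun y => (⟨b y, v y⟩ : TangentBundle 𝓘(ℝ, EG) G)) s x)
    (hw : ContMDiffWithinAt 𝓘(ℝ, EN) 𝓘(ℝ, EG).tangent ∞
      (fun y => (⟨b y, w y⟩ : TangentBundle 𝓘(ℝ, EG) G)) s x) :
    ContMDiffWithinAt 𝓘(ℝ, EN) 𝓘(ℝ, EG).tangent ∞
      (fun y => (⟨b y, v y + w y⟩ : TangentBundle 𝓘(ℝ, EG) G)) s x := by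
  -- Adding `x` to the set makes the eventual equality below hold at `x` itself as well.
  rw [← contMDiffWithinAt_insert_self] at hv hw ⊢
  rw [contMDiffWithinAt_totalSpace] at hv hw ⊢
  refine ⟨hv.1, (hv.2.add hw.2).congr_of_eventuallyEq_of_mem ?_ (Set.mem_insert x s)⟩
  filter_upwards [eventually_trivializationAt_linear hv.1] with y hy
  exact hy.map_add _ _

theorem contMDiffWithinAt_smul {a : N → ℝ} (ha : ContMDiffWithinAt 𝓘(ℝ, EN) 𝓘(ℝ, ℝ) ∞ a s x)
    (hv : ContMDiffWithinAt 𝓘(ℝ, EN) 𝓘(ℝ, EG).tangent ∞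
      (fun y => (⟨b y, v y⟩ : TangentBundle 𝓘(ℝ, EG) G)) s x) :
    ContMDiffWithinAt 𝓘(ℝ, EN) 𝓘(ℝ, EG).tangent ∞
      (fun y => (⟨b y, a y • v y⟩ : TangentBundle 𝓘(ℝ, EG) G)) s x := by
  rw [← contMDiffWithinAt_insert_self] at ha hv ⊢
  rw [contMDiffWithinAt_totalSpace] at hv ⊢
  refine ⟨hv.1, (ha.smul hv.2).congr_of_eventuallyEq_of_mem ?_ (Set.mem_insert x s)⟩
  filter_upwards [eventually_trivializationAt_linear hv.1] with y hy
  exact hy.map_smul _ _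

theorem contMDiffWithinAt_sub
    (hv : ContMDiffWithinAt 𝓘(ℝ, EN) 𝓘(ℝ, EG).tangent ∞
      (fun y => (⟨b y, v y⟩ : TangentBundle 𝓘(ℝ, EG) G)) s x)
    (hw : ContMDiffWithinAt 𝓘(ℝ, EN) 𝓘(ℝ, EG).tangent ∞
      (fun y => (⟨b y, w y⟩ : TangentBundle 𝓘(ℝ, EG) G)) s x) :
    ContMDiffWithinAt 𝓘(ℝ, EN) 𝓘(ℝ, EG).tangent ∞
      (fun y => (⟨b y, v y - w y⟩ : TangentBundle 𝓘(ℝ, EG) G)) s x := by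
  have h := contMDiffWithinAt_add hv
    (contMDiffWithinAt_smul (contMDiffWithinAt_const (c := (-1 : ℝ))) hw)
  simpa only [neg_one_smul, ← sub_eq_add_neg] using h

theorem contMDiffWithinAt_zero (hb : ContMDiffWithinAt 𝓘(ℝ, EN) 𝓘(ℝ, EG) ∞ b s x) :
    ContMDiffWithinAt 𝓘(ℝ, EN) 𝓘(ℝ, EG).tangent ∞
      (fun y => (⟨b y, 0⟩ : TangentBundle 𝓘(ℝ, EG) G)) s x :=
  (contMDiff_zeroSection ℝ (TangentSpace 𝓘(ℝ, EG) : G → Type _) (b x)).comp_contMDiffWithinAt x hb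

theorem contMDiffWithinAt_sum {ι : Type*} (t : Finset ι)
    {V : ι → ∀ x, TangentSpace 𝓘(ℝ, EG) (b x)}
    (hb : ContMDiffWithinAt 𝓘(ℝ, EN) 𝓘(ℝ, EG) ∞ b s x)
    (hV : ∀ i ∈ t, ContMDiffWithinAt 𝓘(ℝ, EN) 𝓘(ℝ, EG).tangent ∞
      (fun y => (⟨b y, V i y⟩ : TangentBundle 𝓘(ℝ, EG) G)) s x) :
    ContMDiffWithinAt 𝓘(ℝ, EN) 𝓘(ℝ, EG).tangent ∞
      (fun y => (⟨b y, ∑ i ∈ t, V i y⟩ : TangentBundle 𝓘(ℝ, EG) G)) s x := by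
  classical
  induction t using Finset.induction_on with
  | empty => simpa using contMDiffWithinAt_zero hb
  | insert i t hi ih =>
    simp only [Finset.sum_insert hi]
    exact contMDiffWithinAt_add (hV i (by simp)) (ih fun j hj => hV j (by simp [hj]))

/-- The derivative of a family of maps, applied to a smooth vector field along a map. -/
theorem contMDiffAt_mfderiv_apply [IsManifold 𝓘(ℝ, EN) ∞ N] [IsManifold 𝓘(ℝ, EQ) ∞ Q]
    {f : N → G → Q} {x : N}
    (hf : ContMDiffAt (𝓘(ℝ, EN).prod 𝓘(ℝ, EG)) 𝓘(ℝ, EQ) ∞ (Function.uncurry f) (x, b x))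
    (hv : ContMDiffAt 𝓘(ℝ, EN) 𝓘(ℝ, EG).tangent ∞
      (fun y => (⟨b y, v y⟩ : TangentBundle 𝓘(ℝ, EG) G)) x) :
    ContMDiffAt 𝓘(ℝ, EN) 𝓘(ℝ, EQ).tangent ∞ (fun y =>
      (⟨f y (b y), mfderiv 𝓘(ℝ, EG) 𝓘(ℝ, EQ) (f y) (b y) (v y)⟩ :
        TangentBundle 𝓘(ℝ, EQ) Q)) x := by
  have hb : ContMDiffAt 𝓘(ℝ, EN) 𝓘(ℝ, EG) ∞ b x := (contMDiffAt_totalSpace.1 hv).1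
  have h := ContMDiffAt.mfderiv f b hf hb (m := ∞) (by simp)
  exact ContMDiffAt.clm_apply_of_inCoordinates h hv
    (ContMDiffAt.comp (f := fun y => (y, b y)) x hf (contMDiffAt_id.prodMk hb))

end Over

end TangentField

namespace LieGroupoid

open TangentField

variable {EG G : Type*} [NormedAddCommGroup EG] [NormedSpace ℝ EG]
  [TopologicalSpace G] [ChartedSpace EG G] [IsManifold 𝓘(ℝ, EG) ∞ G]

theorem contMDiff_lieD {V : ∀ g : G, TangentSpace 𝓘(ℝ, EG) g} {φ : G → ℝ}
    (hV : ContMDiff 𝓘(ℝ, EG) 𝓘(ℝ, EG).tangent ∞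
      (fun g => (⟨g, V g⟩ : TangentBundle 𝓘(ℝ, EG) G)))
    (hφ : ContMDiff 𝓘(ℝ, EG) 𝓘(ℝ, ℝ) ∞ φ) :
    ContMDiff 𝓘(ℝ, EG) 𝓘(ℝ, ℝ) ∞ (lieD V φ) := fun p =>
  (contMDiff_snd_tangentBundle_modelSpace ℝ 𝓘(ℝ, ℝ)).contMDiffAt.comp p
    (contMDiffAt_mfderiv_apply (f := fun _ => φ) (b := id)
      ((hφ p).comp (p, p) contMDiffAt_snd) (hV p))

end LieGroupoid

/-! ### The Lie bracket as a commutator of derivations -/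

namespace LieGroupoid

open VectorField

variable {EG G : Type*} [NormedAddCommGroup EG] [NormedSpace ℝ EG]
  [TopologicalSpace G] [ChartedSpace EG G] [IsManifold 𝓘(ℝ, EG) ∞ G]

/-- Identifies the coordinate expression of `V` with the pullback through which `mlieBracket` is
defined. -/
theorem mfderiv_extChartAt_eq_mpullbackWithin (V : ∀ g : G, TangentSpace 𝓘(ℝ, EG) g) (p : G) :
    ∀ᶠ q in 𝓝 p, mfderiv 𝓘(ℝ, EG) 𝓘(ℝ, EG) (extChartAt 𝓘(ℝ, EG) p) q (V q) =
      mpullbackWithin 𝓘(ℝ, EG) 𝓘(ℝ, EG) (extChartAt 𝓘(ℝ, EG) p).symm V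
        (Set.range 𝓘(ℝ, EG)) (extChartAt 𝓘(ℝ, EG) p q) := by
  filter_upwards [extChartAt_source_mem_nhds (I := 𝓘(ℝ, EG)) p] with q hq
  have hz := (extChartAt 𝓘(ℝ, EG) p).map_source hq
  have hl : (extChartAt 𝓘(ℝ, EG) p).symm (extChartAt 𝓘(ℝ, EG) p q) = q :=
    (extChartAt 𝓘(ℝ, EG) p).left_inv hq
  rw [mpullbackWithin_apply]
  have hinv := isInvertible_mfderivWithin_extChartAt_symm (I := 𝓘(ℝ, EG)) hz
  have hcomp := mfderivWithin_extChartAt_symm_comp_mfderiv_extChartAt' (I := 𝓘(ℝ, EG)) hq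
  have key : V q = mfderivWithin 𝓘(ℝ, EG) 𝓘(ℝ, EG) (extChartAt 𝓘(ℝ, EG) p).symm
      (Set.range 𝓘(ℝ, EG)) (extChartAt 𝓘(ℝ, EG) p q)
      (mfderiv 𝓘(ℝ, EG) 𝓘(ℝ, EG) (extChartAt 𝓘(ℝ, EG) p) q (V q)) :=
    (DFunLike.congr_fun hcomp (V q)).symm
  have hV : (V ((extChartAt 𝓘(ℝ, EG) p).symm (extChartAt 𝓘(ℝ, EG) p q)) : EG) = V q := by
    rw [hl]
  exact (hinv.inverse_apply_eq.2 (hV.trans key)).symm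

/-- Product rule in a chart. Away from critical points of `φ` a first-order term remains; the
Hessian term is symmetric and drops out of commutators. -/
theorem lieD_lieD_chart [CompleteSpace EG] {φ : G → ℝ} (hφ : ContMDiff 𝓘(ℝ, EG) 𝓘(ℝ, ℝ) ∞ φ)
    (p : G) (V : ∀ g : G, TangentSpace 𝓘(ℝ, EG) g) {W : ∀ g : G, TangentSpace 𝓘(ℝ, EG) g}
    (hW : ContMDiff 𝓘(ℝ, EG) 𝓘(ℝ, EG).tangent ∞
      (fun g => (⟨g, W g⟩ : TangentBundle 𝓘(ℝ, EG) G))) :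
    lieD V (lieD W φ) p = hess φ p (V p) (W p) +
      fderiv ℝ (φ ∘ (extChartAt 𝓘(ℝ, EG) p).symm) (extChartAt 𝓘(ℝ, EG) p p)
        (fderiv ℝ (mpullbackWithin 𝓘(ℝ, EG) 𝓘(ℝ, EG) (extChartAt 𝓘(ℝ, EG) p).symm W
          (Set.range 𝓘(ℝ, EG)) : EG → EG) (extChartAt 𝓘(ℝ, EG) p p) (V p)) := by
  set f := φ ∘ (extChartAt 𝓘(ℝ, EG) p).symm with hf
  set w : EG → EG := mpullbackWithin 𝓘(ℝ, EG) 𝓘(ℝ, EG) (extChartAt 𝓘(ℝ, EG) p).symm W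
    (Set.range 𝓘(ℝ, EG)) with hw
  set z := extChartAt 𝓘(ℝ, EG) p p with hz
  have hwd : DifferentiableAt ℝ w z := by
    have h := MDifferentiableWithinAt.differentiableWithinAt_mpullbackWithin_vectorField
      (s := Set.univ) ((hW p).mdifferentiableAt (by simp)).mdifferentiableWithinAt
    have hs : (extChartAt 𝓘(ℝ, EG) p).symm ⁻¹' Set.univ ∩ Set.range 𝓘(ℝ, EG) = Set.univ := by simp
    rw [hs] at h
    exact differentiableWithinAt_univ.1 h
  have hfd : DifferentiableAt ℝ (fderiv ℝ f) z :=
    ((contDiffAt_chart hφ p).fderiv_right (m := 1) (by norm_cast)).differentiableAt (by simp)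
  have e : lieD W φ =ᶠ[𝓝 p] (fun y => fderiv ℝ f y (w y)) ∘ extChartAt 𝓘(ℝ, EG) p := by
    filter_upwards [mfderiv_eq_chart hφ p, mfderiv_extChartAt_eq_mpullbackWithin W p] with q hq hq'
    exact (hq _).trans (congrArg _ hq')
  have hD := (hfd.hasFDerivAt.clm_apply hwd.hasFDerivAt).hasMFDerivAt.comp p
    (mdifferentiableAt_extChartAt (I := 𝓘(ℝ, EG)) (mem_chart_source EG p)).hasMFDerivAt
  have key := congrArg (fun L => L (V p)) (hD.congr_of_eventuallyEq e).mfderiv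
  refine key.trans ?_
  have hid := mfderiv_extChartAt_self (I := 𝓘(ℝ, EG)) (x := p)
  have hwp : w z = W p := by
    have h := (mfderiv_extChartAt_eq_mpullbackWithin W p).self_of_nhds
    exact h.symm.trans (DFunLike.congr_fun hid (W p))
  have hvp : mfderiv 𝓘(ℝ, EG) 𝓘(ℝ, EG) (extChartAt 𝓘(ℝ, EG) p) p (V p) = V p :=
    DFunLike.congr_fun hid (V p)
  change fderiv ℝ f z (fderiv ℝ w z (mfderiv 𝓘(ℝ, EG) 𝓘(ℝ, EG) (extChartAt 𝓘(ℝ, EG) p) p (V p))) +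
    fderiv ℝ (fderiv ℝ f) z
      (mfderiv 𝓘(ℝ, EG) 𝓘(ℝ, EG) (extChartAt 𝓘(ℝ, EG) p) p (V p)) (w z) = _
  rw [hvp, hwp, add_comm]
  rfl

/-- The Lie bracket of vector fields is the commutator of the associated derivations. -/
theorem lieD_mlieBracket [CompleteSpace EG] {φ : G → ℝ} (hφ : ContMDiff 𝓘(ℝ, EG) 𝓘(ℝ, ℝ) ∞ φ)
    {V W : ∀ g : G, TangentSpace 𝓘(ℝ, EG) g}
    (hV : ContMDiff 𝓘(ℝ, EG) 𝓘(ℝ, EG).tangent ∞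
      (fun g => (⟨g, V g⟩ : TangentBundle 𝓘(ℝ, EG) G)))
    (hW : ContMDiff 𝓘(ℝ, EG) 𝓘(ℝ, EG).tangent ∞
      (fun g => (⟨g, W g⟩ : TangentBundle 𝓘(ℝ, EG) G))) (p : G) :
    lieD (mlieBracket 𝓘(ℝ, EG) V W) φ p = lieD V (lieD W φ) p - lieD W (lieD V φ) p := by
  -- With the Hessians cancelled, what remains is dφ applied to DW·V - DV·W, the bracket in
  -- coordinates.
  rw [lieD_lieD_chart hφ p V hW, lieD_lieD_chart hφ p W hV, hess_symm hφ p (W p) (V p),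
    add_sub_add_left_eq_sub]
  have hid := mfderiv_extChartAt_self (I := 𝓘(ℝ, EG)) (x := p)
  have hval (U : ∀ g : G, TangentSpace 𝓘(ℝ, EG) g) :
      (mpullbackWithin 𝓘(ℝ, EG) 𝓘(ℝ, EG) (extChartAt 𝓘(ℝ, EG) p).symm U
        (Set.range 𝓘(ℝ, EG)) : EG → EG) (extChartAt 𝓘(ℝ, EG) p p) = U p :=
    (mfderiv_extChartAt_eq_mpullbackWithin U p).self_of_nhds.symm.trans
      (DFunLike.congr_fun hid (U p))
  have hl := (mfderiv_eq_chart hφ p).self_of_nhds (mlieBracket 𝓘(ℝ, EG) V W p)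
  refine hl.trans ?_
  have hB : mfderiv 𝓘(ℝ, EG) 𝓘(ℝ, EG) (extChartAt 𝓘(ℝ, EG) p) p (mlieBracket 𝓘(ℝ, EG) V W p) =
      lieBracketWithin ℝ
        (mpullbackWithin 𝓘(ℝ, EG) 𝓘(ℝ, EG) (extChartAt 𝓘(ℝ, EG) p).symm V (Set.range 𝓘(ℝ, EG)))
        (mpullbackWithin 𝓘(ℝ, EG) 𝓘(ℝ, EG) (extChartAt 𝓘(ℝ, EG) p).symm W (Set.range 𝓘(ℝ, EG)))
        ((extChartAt 𝓘(ℝ, EG) p).symm ⁻¹' Set.univ ∩ Set.range 𝓘(ℝ, EG))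
        (extChartAt 𝓘(ℝ, EG) p p) := by
    rw [← mlieBracketWithin_univ, mlieBracketWithin_apply]
    exact (isInvertible_mfderiv_extChartAt (I := 𝓘(ℝ, EG))
      (mem_extChartAt_source p)).self_apply_inverse _
  have hs : (extChartAt 𝓘(ℝ, EG) p).symm ⁻¹' Set.univ ∩ Set.range 𝓘(ℝ, EG) = Set.univ := by simp
  rw [hs] at hB
  rw [← map_sub, ← hval V, ← hval W]
  refine congrArg _ (hB.trans ?_)
  exact congrFun (lieBracketWithin_univ (𝕜 := ℝ) (V := (mpullbackWithin 𝓘(ℝ, EG) 𝓘(ℝ, EG)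
    (extChartAt 𝓘(ℝ, EG) p).symm V (Set.range 𝓘(ℝ, EG)) : EG → EG))) _

end LieGroupoid

/-! ### Local retractions onto the fibres of a submersion -/

namespace TangentField

open Bundle

variable {EM EG EQ M G Q : Type*}
  [NormedAddCommGroup EM] [NormedSpace ℝ EM]
  [NormedAddCommGroup EG] [NormedSpace ℝ EG] [NormedAddCommGroup EQ] [NormedSpace ℝ EQ]
  [TopologicalSpace M] [ChartedSpace EM M]
  [TopologicalSpace G] [ChartedSpace EG G] [TopologicalSpace Q] [ChartedSpace EQ Q]

/-- All tangent spaces are the model space by definition, so vectors at propositionally equal points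
can be compared there. -/
theorem mk_congr {p q : G} (h : p = q) {v : TangentSpace 𝓘(ℝ, EG) p} {w : TangentSpace 𝓘(ℝ, EG) q}
    (hvw : (v : EG) = (w : EG)) :
    (⟨p, v⟩ : TangentBundle 𝓘(ℝ, EG) G) = ⟨q, w⟩ := by
  subst h
  exact congrArg _ hvw

/-- A submersion admits, near every point, a smooth family of retractions onto its fibres. -/
theorem exists_retraction_of_isSubmersionAt {f : G → M} {u : G}
    (hf : Manifold.IsSubmersionAt 𝓘(ℝ, EG) 𝓘(ℝ, EM) ∞ f u) :
    ∃ r : M → G → G,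
      ContMDiffAt (𝓘(ℝ, EM).prod 𝓘(ℝ, EG)) 𝓘(ℝ, EG) ∞ (Function.uncurry r) (f u, u) ∧
      (∀ᶠ p : M × G in 𝓝 (f u, u), f (r p.1 p.2) = p.1) ∧ ∀ᶠ h in 𝓝 u, r (f h) h = h := by
  obtain ⟨φ, hφ, hφu⟩ : ∃ φ, φ = hf.domChart ∧ u ∈ φ.source := ⟨_, rfl, hf.mem_domChart_source⟩
  obtain ⟨ψ, hψ, hψu⟩ : ∃ ψ, ψ = hf.codChart ∧ f u ∈ ψ.source := ⟨_, rfl, hf.mem_codChart_source⟩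
  have hφm : φ ∈ IsManifold.maximalAtlas 𝓘(ℝ, EG) ∞ G := hφ ▸ hf.domChart_mem_maximalAtlas
  have hψm : ψ ∈ IsManifold.maximalAtlas 𝓘(ℝ, EM) ∞ M := hψ ▸ hf.codChart_mem_maximalAtlas
  have hsub : φ.source ⊆ f ⁻¹' ψ.source := hφ ▸ hψ ▸ hf.source_subset_preimage_source
  set e := hf.equiv
  have hw : ∀ z ∈ φ.target, ψ (f (φ.symm z)) = (e z).1 := by
    intro z hz
    have := hf.writtenInCharts
      (show z ∈ (hf.domChart.extend 𝓘(ℝ, EG)).target by simpa [← hφ] using hz)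
    simpa [← hφ, ← hψ] using this
  have hwu : ∀ h ∈ φ.source, ψ (f h) = (e (φ h)).1 := fun h hh => by
    rw [← hw _ (φ.map_source hh), φ.left_inv hh]
  -- In the adapted charts `f` is the first projection; `c` overwrites the first coordinate of `h`
  -- by that of the prescribed base point.
  set c : M × G → EG := fun p => e.symm (ψ p.1, (e (φ p.2)).2) with hc
  have hcu : c (f u, u) = φ u := by
    simp [hc, hwu u hφu]
  have hcs : ContMDiffAt (𝓘(ℝ, EM).prod 𝓘(ℝ, EG)) 𝓘(ℝ, EG) ∞ c (f u, u) := by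
    have h1 : ContMDiffAt (𝓘(ℝ, EM).prod 𝓘(ℝ, EG)) 𝓘(ℝ, EM) ∞ (fun p : M × G => ψ p.1) (f u, u) :=
      (contMDiffAt_of_mem_maximalAtlas hψm hψu).comp (f u, u) contMDiffAt_fst
    have h2 : ContMDiffAt (𝓘(ℝ, EM).prod 𝓘(ℝ, EG)) 𝓘(ℝ, EG) ∞ (fun p : M × G => φ p.2) (f u, u) :=
      (contMDiffAt_of_mem_maximalAtlas hφm hφu).comp (f u, u) contMDiffAt_snd
    have h3 := (((ContinuousLinearMap.snd ℝ EM hf.complement).comp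
      e.toContinuousLinearMap).contDiff (n := ∞)).contMDiff.contMDiffAt.comp (f u, u) h2
    exact (e.symm.contDiff (n := ∞)).contMDiff.contMDiffAt.comp (f u, u) (h1.prodMk_space h3)
  refine ⟨fun x h => φ.symm (c (x, h)), ?_, ?_, ?_⟩
  · refine ContMDiffAt.comp (f u, u) (g := φ.symm) (f := c) ?_ hcs
    rw [hcu]
    exact contMDiffAt_symm_of_mem_maximalAtlas hφm (φ.map_source hφu)
  · have h1 : ∀ᶠ p in 𝓝 (f u, u), c p ∈ φ.target :=
      hcs.continuousAt.eventually (by rw [hcu]; exact φ.open_target.mem_nhds (φ.map_source hφu))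
    have h2 : ∀ᶠ p : M × G in 𝓝 (f u, u), p.1 ∈ ψ.source :=
      continuousAt_fst.eventually (ψ.open_source.mem_nhds hψu)
    filter_upwards [h1, h2] with p hp hp'
    refine ψ.injOn (hsub (φ.map_target hp)) hp' ?_
    rw [hw _ hp]
    simp [hc]
  · filter_upwards [φ.open_source.mem_nhds hφu] with h hh
    have : c (f h, h) = φ h := by simp [hc, hwu h hh]
    rw [this, φ.left_inv hh]

/-- A derivative within a fibre is determined on the kernel of the derivative of the submersion. -/
theorem hasMFDerivWithinAt_fiber_apply {f : G → M} {u : G} {r : M → G → G}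
    (hf : MDifferentiableAt 𝓘(ℝ, EG) 𝓘(ℝ, EM) f u)
    (hr : MDifferentiableAt (𝓘(ℝ, EM).prod 𝓘(ℝ, EG)) 𝓘(ℝ, EG) (Function.uncurry r) (f u, u))
    (h₁ : ∀ᶠ h in 𝓝 u, f (r (f u) h) = f u) (h₂ : ∀ᶠ h in 𝓝 u, r (f h) h = h)
    {φ : G → Q} {A : TangentSpace 𝓘(ℝ, EG) u →L[ℝ] TangentSpace 𝓘(ℝ, EQ) (φ u)}
    (hφ : HasMFDerivWithinAt 𝓘(ℝ, EG) 𝓘(ℝ, EQ) φ {h | f h = f u} u A)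
    {v : TangentSpace 𝓘(ℝ, EG) u} (hv : mfderiv 𝓘(ℝ, EG) 𝓘(ℝ, EM) f u v = 0) :
    (mfderiv 𝓘(ℝ, EG) 𝓘(ℝ, EQ) (fun h => φ (r (f u) h)) u v : EQ) = A v := by
  have hru : r (f u) u = u := h₂.self_of_nhds
  set L := mfderiv (𝓘(ℝ, EM).prod 𝓘(ℝ, EG)) 𝓘(ℝ, EG) (Function.uncurry r) (f u, u) with hL
  have hid : HasMFDerivAt 𝓘(ℝ, EG) 𝓘(ℝ, EG) (fun h => r (f h) h) u
      (L.comp ((mfderiv 𝓘(ℝ, EG) 𝓘(ℝ, EM) f u).prod (ContinuousLinearMap.id ℝ _))) :=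
    HasMFDerivAt.comp (g := Function.uncurry r) (f := fun h => (f h, h)) u hr.hasMFDerivAt
      (hf.hasMFDerivAt.prodMk (hasMFDerivAt_id u))
  have hid' := (hid.congr_of_eventuallyEq (f₁ := id) (by
    filter_upwards [h₂] with h hh using hh.symm)).mfderiv
  rw [mfderiv_id] at hid'
  -- Differentiate r (f h) h = h along `v`: as `v` is killed by df, only the derivative in the
  -- second variable contributes, so that derivative fixes `v`.
  have hLv : (L ((0 : EM), v) : EG) = v := by
    have := DFunLike.congr_fun hid' v
    refine Eq.trans ?_ this.symm
    change L ((0 : EM), v) = L (mfderiv 𝓘(ℝ, EG) 𝓘(ℝ, EM) f u v, v)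
    rw [hv]
    rfl
  have hD : HasMFDerivAt 𝓘(ℝ, EG) 𝓘(ℝ, EG) (r (f u)) u
      (L.comp ((0 : EG →L[ℝ] EM).prod (ContinuousLinearMap.id ℝ EG))) :=
    HasMFDerivAt.comp (g := Function.uncurry r) (f := fun h => (f u, h)) u hr.hasMFDerivAt
      ((hasMFDerivAt_const (f u) u).prodMk (hasMFDerivAt_id u))
  -- The retraction lands in the fibre, so any derivative of `φ` within the fibre can be composed
  -- with it; by `h₁` the set here is a neighbourhood of `u`.
  have hcomp : HasMFDerivWithinAt 𝓘(ℝ, EG) 𝓘(ℝ, EQ) (fun h => φ (r (f u) h))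
      {h | f (r (f u) h) = f u} u
      (A.comp (L.comp ((0 : EG →L[ℝ] EM).prod (ContinuousLinearMap.id ℝ EG)))) :=
    HasMFDerivWithinAt.comp (g := φ) (f := r (f u)) (u := {h | f h = f u}) u
      (by rw [hru]; exact hφ) hD.hasMFDerivWithinAt (fun h hh => hh)
  have := congrArg (fun B => B v) (hcomp.hasMFDerivAt h₁).mfderiv
  refine this.trans ?_
  exact congrArg A hLv

end TangentField

/-! ### Invariant vector fields: values at units and smoothness -/

namespace LieGroupoid

open TangentField Bundle

variable {EM EG M G : Type*}
  [NormedAddCommGroup EM] [NormedSpace ℝ EM] [NormedAddCommGroup EG] [NormedSpace ℝ EG]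
  [TopologicalSpace M] [ChartedSpace EM M] [TopologicalSpace G] [ChartedSpace EG G]

/-- The opposite groupoid, with source and target exchanged. -/
def op (𝒢 : LieGroupoid EM EG M G) : LieGroupoid EM EG M G where
  src := 𝒢.tgt
  tgt := 𝒢.src
  unit := 𝒢.unit
  mul g h := 𝒢.mul h g
  inv := 𝒢.inv
  isSubmersion_src := 𝒢.isSubmersion_tgt
  isSubmersion_tgt := 𝒢.isSubmersion_src
  isSmoothEmbedding_unit := 𝒢.isSmoothEmbedding_unit
  contMDiffOn_mul := 𝒢.contMDiffOn_mul.comp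
    (contMDiff_snd.prodMk contMDiff_fst).contMDiffOn fun _ hp => Eq.symm hp
  contMDiff_inv := 𝒢.contMDiff_inv
  src_unit := 𝒢.tgt_unit
  tgt_unit := 𝒢.src_unit
  src_mul g h hgh := 𝒢.tgt_mul h g hgh.symm
  tgt_mul g h hgh := 𝒢.src_mul h g hgh.symm
  mul_assoc g h k hgh hhk := (𝒢.mul_assoc k h g hhk.symm hgh.symm).symm
  unit_mul := 𝒢.mul_unit
  mul_unit := 𝒢.unit_mul
  src_inv := 𝒢.tgt_inv
  tgt_inv := 𝒢.src_inv
  mul_inv := 𝒢.inv_mul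
  inv_mul := 𝒢.mul_inv

variable (𝒢 : LieGroupoid EM EG M G)

theorem dTgt_leftRep (x : M) (e : 𝒢.Fiber x) : 𝒢.dTgt x (𝒢.leftRep x e) = 0 := by
  obtain ⟨v, rfl⟩ := Submodule.mkQ_surjective _ e
  change 𝒢.dTgt x (v - 𝒢.dUnit x (𝒢.dTgt x v)) = 0
  rw [map_sub, 𝒢.dTgt_dUnit, sub_self]

theorem toFiber_leftRep (x : M) (e : 𝒢.Fiber x) : 𝒢.toFiber x (𝒢.leftRep x e) = e := by
  obtain ⟨v, rfl⟩ := Submodule.mkQ_surjective _ e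
  change 𝒢.toFiber x (v - 𝒢.dUnit x (𝒢.dTgt x v)) = 𝒢.toFiber x v
  rw [map_sub, sub_eq_self]
  exact (Submodule.Quotient.mk_eq_zero _).2 ⟨_, rfl⟩

theorem leftRep_injective (x : M) : Function.Injective (𝒢.leftRep x) :=
  Function.LeftInverse.injective (𝒢.toFiber_leftRep x)

theorem contMDiff_unit : ContMDiff 𝓘(ℝ, EM) 𝓘(ℝ, EG) ∞ 𝒢.unit :=
  𝒢.isSmoothEmbedding_unit.contMDiff

theorem mdifferentiableWithinAt_mul_left (g : G) :
    MDifferentiableWithinAt 𝓘(ℝ, EG) 𝓘(ℝ, EG) (fun h => 𝒢.mul g h) {h | 𝒢.tgt h = 𝒢.src g}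
      (𝒢.unit (𝒢.src g)) := by
  have h : ContMDiffOn 𝓘(ℝ, EG) 𝓘(ℝ, EG) ∞ (fun h => 𝒢.mul g h) {h | 𝒢.tgt h = 𝒢.src g} :=
    𝒢.contMDiffOn_mul.comp (f := fun h => (g, h))
      (contMDiff_const.prodMk contMDiff_id).contMDiffOn fun h hh => Eq.symm hh
  exact (h _ (𝒢.tgt_unit _)).mdifferentiableWithinAt (by simp)

/-- The left-invariant field through a retraction of `G` onto a fibre of the target. -/
theorem leftField_eq_mfderiv (X : ∀ x, 𝒢.Fiber x) {g : G} {r : M → G → G}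
    (hr : MDifferentiableAt (𝓘(ℝ, EM).prod 𝓘(ℝ, EG)) 𝓘(ℝ, EG) (Function.uncurry r)
      (𝒢.src g, 𝒢.unit (𝒢.src g)))
    (h₁ : ∀ᶠ h in 𝓝 (𝒢.unit (𝒢.src g)), 𝒢.tgt (r (𝒢.src g) h) = 𝒢.src g)
    (h₂ : ∀ᶠ h in 𝓝 (𝒢.unit (𝒢.src g)), r (𝒢.tgt h) h = h)
    {A : EG →L[ℝ] EG} (hA : HasMFDerivWithinAt 𝓘(ℝ, EG) 𝓘(ℝ, EG) (fun h => 𝒢.mul g h)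
      {h | 𝒢.tgt h = 𝒢.src g} (𝒢.unit (𝒢.src g)) A) :
    (𝒢.leftField X g : EG) = mfderiv 𝓘(ℝ, EG) 𝓘(ℝ, EG) (fun h => 𝒢.mul g (r (𝒢.src g) h))
      (𝒢.unit (𝒢.src g)) (𝒢.leftRep (𝒢.src g) (X (𝒢.src g))) ∧
    (𝒢.leftField X g : EG) = A (𝒢.leftRep (𝒢.src g) (X (𝒢.src g))) := by
  have ht := 𝒢.tgt_unit (𝒢.src g)
  -- Derivatives within a fibre need not be unique on all of `EG`, but they agree on the kernel of
  -- the differential of `tgt`, where `leftRep` takes its values. The statement is used both for the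
  -- derivative chosen by `mfderivWithin` and for `A`.
  have key {B : EG →L[ℝ] EG} (hB : HasMFDerivWithinAt 𝓘(ℝ, EG) 𝓘(ℝ, EG) (fun h => 𝒢.mul g h)
      {h | 𝒢.tgt h = 𝒢.src g} (𝒢.unit (𝒢.src g)) B) :=
    hasMFDerivWithinAt_fiber_apply (f := 𝒢.tgt) (u := 𝒢.unit (𝒢.src g)) (r := r)
      ((𝒢.isSubmersion_tgt.contMDiff _).mdifferentiableAt (by simp))
      (by rw [ht]; exact hr) (by rw [ht]; exact h₁) h₂ (φ := fun h => 𝒢.mul g h)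
      (A := B) (by rw [ht]; exact hB) (𝒢.dTgt_leftRep _ (X (𝒢.src g)))
  rw [ht] at key
  have k₁ := key (𝒢.mdifferentiableWithinAt_mul_left g).hasMFDerivWithinAt
  exact ⟨k₁.symm, k₁.symm.trans (key hA)⟩

/-- Left translation by a unit is the identity on the target fibre, so the identity is one of its
derivatives there. -/
theorem leftField_unit (X : ∀ x, 𝒢.Fiber x) (x : M) :
    𝒢.leftField X (𝒢.unit x) = 𝒢.leftRep x (X x) := by
  obtain ⟨r, hr, h₁, h₂⟩ := exists_retraction_of_isSubmersionAt
    (𝒢.isSubmersion_tgt.isSubmersionAt (𝒢.unit (𝒢.src (𝒢.unit x))))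
  rw [𝒢.tgt_unit] at hr h₁
  have hA : HasMFDerivWithinAt 𝓘(ℝ, EG) 𝓘(ℝ, EG) (fun h => 𝒢.mul (𝒢.unit x) h)
      {h | 𝒢.tgt h = 𝒢.src (𝒢.unit x)} (𝒢.unit (𝒢.src (𝒢.unit x)))
      (ContinuousLinearMap.id ℝ EG) := by
    have he : ∀ h ∈ {h | 𝒢.tgt h = 𝒢.src (𝒢.unit x)}, 𝒢.mul (𝒢.unit x) h = id h := by
      intro h hh
      rw [Set.mem_ofPred_eq, 𝒢.src_unit] at hh
      rw [← hh, 𝒢.unit_mul, id]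
    exact (hasMFDerivWithinAt_id _ _).congr_mono he (he _ (𝒢.tgt_unit _)) subset_rfl
  have h := (𝒢.leftField_eq_mfderiv X (hr.mdifferentiableAt (by simp))
    ((Continuous.prodMk_right _).continuousAt.eventually h₁) h₂ hA).2
  have hy (y : M) (hy : y = x) : (𝒢.leftRep y (X y) : EG) = 𝒢.leftRep x (X x) := by
    subst hy
    rfl
  exact h.trans (hy _ (𝒢.src_unit x))

theorem toFiber_leftField_unit (X : ∀ x, 𝒢.Fiber x) (x : M) :
    𝒢.toFiber x (𝒢.leftField X (𝒢.unit x)) = X x := by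
  rw [leftField_unit, toFiber_leftRep]

/-- Right-invariant fields are, by definition, the left-invariant fields of the opposite groupoid,
whose Lie(G) has the same fibres. -/
theorem toFiber_rightField_unit (X : ∀ x, 𝒢.Fiber x) (x : M) :
    𝒢.toFiber x (𝒢.rightField X (𝒢.unit x)) = X x :=
  𝒢.op.toFiber_leftField_unit X x

variable [IsManifold 𝓘(ℝ, EG) ∞ G]

/-- For any smooth representative `V`, the left representative is `V` minus its image under the
differential of `unit ∘ tgt`. -/
theorem contMDiffAt_leftRep [IsManifold 𝓘(ℝ, EM) ∞ M] {X : ∀ x, 𝒢.Fiber x} (hX : 𝒢.IsSection X)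
    (x : M) : ContMDiffAt 𝓘(ℝ, EM) 𝓘(ℝ, EG).tangent ∞
      (fun x => (⟨𝒢.unit x, 𝒢.leftRep x (X x)⟩ : TangentBundle 𝓘(ℝ, EG) G)) x := by
  obtain ⟨V, hV, hVX⟩ := hX
  have hV : ContMDiffAt 𝓘(ℝ, EM) 𝓘(ℝ, EG).tangent ∞
      (fun x => (⟨𝒢.unit x, V x⟩ : TangentBundle 𝓘(ℝ, EG) G)) x :=
    (hV x (Set.mem_univ x)).contMDiffAt Filter.univ_mem
  have ht : ContMDiff 𝓘(ℝ, EG) 𝓘(ℝ, EM) ∞ 𝒢.tgt := 𝒢.isSubmersion_tgt.contMDiff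
  have h₁ := contMDiffAt_mfderiv_apply (f := fun _ : M => 𝒢.unit ∘ 𝒢.tgt)
    (((𝒢.contMDiff_unit.comp ht) (𝒢.unit x)).comp (x, 𝒢.unit x) contMDiffAt_snd) hV
  have h₂ : ContMDiffAt 𝓘(ℝ, EM) 𝓘(ℝ, EG).tangent ∞
      (fun x => (⟨𝒢.unit x, 𝒢.dUnit x (𝒢.dTgt x (V x))⟩ : TangentBundle 𝓘(ℝ, EG) G)) x := by
    refine h₁.congr_of_eventuallyEq (.of_forall fun y => ?_)
    refine mk_congr (congrArg 𝒢.unit (𝒢.tgt_unit y)).symm ?_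
    have hu : MDifferentiableAt 𝓘(ℝ, EM) 𝓘(ℝ, EG) 𝒢.unit y :=
      (𝒢.contMDiff_unit y).mdifferentiableAt (by simp)
    have := mfderiv_comp_apply_of_eq (x := 𝒢.unit y) (y := y) hu
      ((ht (𝒢.unit y)).mdifferentiableAt (by simp)) (𝒢.tgt_unit y) (V y)
    exact this.symm
  have h := contMDiffWithinAt_sub hV.contMDiffWithinAt (s := Set.univ) h₂.contMDiffWithinAt
  refine (h.contMDiffAt Filter.univ_mem).congr_of_eventuallyEq (.of_forall fun y => ?_)
  exact mk_congr rfl (congrArg (𝒢.leftRep y) (hVX y (Set.mem_univ y)).symm)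

/-- Left-invariant vector fields are smooth. -/
theorem contMDiff_leftField [IsManifold 𝓘(ℝ, EM) ∞ M] {X : ∀ x, 𝒢.Fiber x}
    (hX : 𝒢.IsSection X) :
    ContMDiff 𝓘(ℝ, EG) 𝓘(ℝ, EG).tangent ∞
      (fun g => (⟨g, 𝒢.leftField X g⟩ : TangentBundle 𝓘(ℝ, EG) G)) := by
  intro g₀
  obtain ⟨r, hr, h₁, h₂⟩ := exists_retraction_of_isSubmersionAt
    (𝒢.isSubmersion_tgt.isSubmersionAt (𝒢.unit (𝒢.src g₀)))
  rw [𝒢.tgt_unit] at hr h₁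
  have hs : ContMDiff 𝓘(ℝ, EG) 𝓘(ℝ, EM) ∞ 𝒢.src := 𝒢.isSubmersion_src.contMDiff
  have hru : r (𝒢.src g₀) (𝒢.unit (𝒢.src g₀)) = 𝒢.unit (𝒢.src g₀) := by
    simpa [𝒢.tgt_unit] using h₂.self_of_nhds
  -- With `r` inserted, all pairs near the base point become composable, and smoothness on the
  -- composable set turns into smoothness on a neighbourhood.
  have hm : ContMDiffAt (𝓘(ℝ, EG).prod 𝓘(ℝ, EG)) 𝓘(ℝ, EG) ∞
      (Function.uncurry fun g h => 𝒢.mul g (r (𝒢.src g) h)) (g₀, 𝒢.unit (𝒢.src g₀)) := by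
    have hsrc : ContMDiffAt (𝓘(ℝ, EG).prod 𝓘(ℝ, EG)) (𝓘(ℝ, EM).prod 𝓘(ℝ, EG)) ∞
        (fun p : G × G => (𝒢.src p.1, p.2)) (g₀, 𝒢.unit (𝒢.src g₀)) :=
      ((hs _).comp _ contMDiffAt_fst).prodMk contMDiffAt_snd
    have hin : ContMDiffAt (𝓘(ℝ, EG).prod 𝓘(ℝ, EG)) (𝓘(ℝ, EG).prod 𝓘(ℝ, EG)) ∞
        (fun p : G × G => (p.1, r (𝒢.src p.1) p.2)) (g₀, 𝒢.unit (𝒢.src g₀)) :=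
      contMDiffAt_fst.prodMk (hr.comp (f := fun p : G × G => (𝒢.src p.1, p.2)) _ hsrc)
    refine (ContMDiffWithinAt.comp (g := fun p : G × G => 𝒢.mul p.1 p.2)
      (s := {p : G × G | 𝒢.tgt (r (𝒢.src p.1) p.2) = 𝒢.src p.1}) _
      (𝒢.contMDiffOn_mul _ ?_) hin.contMDiffWithinAt fun p hp => Eq.symm hp).contMDiffAt
      (hsrc.continuousAt.eventually h₁)
    simp [hru, 𝒢.tgt_unit]
  have hv : ContMDiffAt 𝓘(ℝ, EG) 𝓘(ℝ, EG).tangent ∞ (fun g =>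
      (⟨𝒢.unit (𝒢.src g), 𝒢.leftRep (𝒢.src g) (X (𝒢.src g))⟩ : TangentBundle 𝓘(ℝ, EG) G)) g₀ :=
    (𝒢.contMDiffAt_leftRep hX (𝒢.src g₀)).comp g₀ (hs g₀)
  refine (contMDiffAt_mfderiv_apply (f := fun g h => 𝒢.mul g (r (𝒢.src g) h))
    hm hv).congr_of_eventuallyEq ?_
  have hc : ContinuousAt (fun g => (𝒢.src g, 𝒢.unit (𝒢.src g))) g₀ :=
    (hs.continuous.prodMk (𝒢.contMDiff_unit.continuous.comp hs.continuous)).continuousAt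
  -- One retraction must serve all `g` near `g₀`, so its differentiability is spread to nearby
  -- points; being C^1 is an open condition.
  have hr1 : ∀ᶠ p in 𝓝 (𝒢.src g₀, 𝒢.unit (𝒢.src g₀)),
      ContMDiffAt (𝓘(ℝ, EM).prod 𝓘(ℝ, EG)) 𝓘(ℝ, EG) 1 (Function.uncurry r) p :=
    (contMDiffAt_iff_contMDiffAt_nhds (by simp)).1 (hr.of_le (by norm_cast))
  filter_upwards [hc.eventually hr1, hc.eventually h₁.eventually_nhds,
    (continuousAt_snd.comp hc).eventually h₂.eventually_nhds] with g e₁ e₂ e₃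
  have e₄ : r (𝒢.src g) (𝒢.unit (𝒢.src g)) = 𝒢.unit (𝒢.src g) := by
    simpa [𝒢.tgt_unit] using e₃.self_of_nhds
  refine mk_congr ?_ (𝒢.leftField_eq_mfderiv X (e₁.mdifferentiableAt (by simp))
    ((Continuous.prodMk_right _).continuousAt.eventually e₂) e₃
    (𝒢.mdifferentiableWithinAt_mul_left g).hasMFDerivWithinAt).1
  rw [e₄, 𝒢.mul_unit]

/-- Right-invariant vector fields are smooth. -/
theorem contMDiff_rightField [IsManifold 𝓘(ℝ, EM) ∞ M] {X : ∀ x, 𝒢.Fiber x}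
    (hX : 𝒢.IsSection X) :
    ContMDiff 𝓘(ℝ, EG) 𝓘(ℝ, EG).tangent ∞
      (fun g => (⟨g, 𝒢.rightField X g⟩ : TangentBundle 𝓘(ℝ, EG) G)) :=
  𝒢.op.contMDiff_leftField hX

end LieGroupoid

/-! ### Closure of the kernel under the bracket -/

namespace LieGroupoid

open TangentField Bundle VectorField

variable {EM EG M G : Type*}
  [NormedAddCommGroup EM] [NormedSpace ℝ EM] [NormedAddCommGroup EG] [NormedSpace ℝ EG]
  [TopologicalSpace M] [ChartedSpace EM M] [TopologicalSpace G] [ChartedSpace EG G]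

theorem lieD_sub (V : ∀ g : G, TangentSpace 𝓘(ℝ, EG) g) {φ ψ : G → ℝ}
    (hφ : ContMDiff 𝓘(ℝ, EG) 𝓘(ℝ, ℝ) ∞ φ) (hψ : ContMDiff 𝓘(ℝ, EG) 𝓘(ℝ, ℝ) ∞ ψ) (p : G) :
    lieD V (fun g => φ g - ψ g) p = lieD V φ p - lieD V ψ p := by
  have h := (((hφ p).mdifferentiableAt (by simp)).hasMFDerivAt.sub
    ((hψ p).mdifferentiableAt (by simp)).hasMFDerivAt).mfderiv
  exact DFunLike.congr_fun h (V p)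

variable [IsManifold 𝓘(ℝ, EG) ∞ G] (𝒢 : LieGroupoid EM EG M G)

/-- Vectors tangent to M lie in the radical of the Hessian, so any representatives compute the form.
-/
theorem metric_toFiber {F : G → ℝ} (hF : 𝒢.IsContrast F) (x : M)
    (v w : TangentSpace 𝓘(ℝ, EG) (𝒢.unit x)) :
    𝒢.metric F x (𝒢.toFiber x v) (𝒢.toFiber x w) = hess F (𝒢.unit x) v w := by
  have h (v) : 𝒢.leftRep x (𝒢.toFiber x v) = v - 𝒢.dUnit x (𝒢.dTgt x v) := rfl
  have h' (v a) : hess F (𝒢.unit x) v (𝒢.dUnit x a) = 0 := by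
    rw [hess_symm hF.contMDiff, 𝒢.hess_dUnit hF, LinearMap.zero_apply]
  simp only [metric, LinearMap.compl₁₂_apply, h, map_sub, h', 𝒢.hess_dUnit hF, sub_zero]

theorem metric_symm {F : G → ℝ} (hF : 𝒢.IsContrast F) (x : M) (a b : 𝒢.Fiber x) :
    𝒢.metric F x a b = 𝒢.metric F x b a := by
  obtain ⟨v, rfl⟩ := Submodule.mkQ_surjective _ a
  obtain ⟨w, rfl⟩ := Submodule.mkQ_surjective _ b
  exact (𝒢.metric_toFiber hF x v w).trans
    ((hess_symm hF.contMDiff _ v w).trans (𝒢.metric_toFiber hF x w v).symm)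

/-- The derivative of a contrast function along a vector field representing a section of its kernel
is again a contrast function. -/
theorem IsContrast.lieD {F : G → ℝ} (hF : 𝒢.IsContrast F) {W : ∀ g : G, TangentSpace 𝓘(ℝ, EG) g}
    (hW : ContMDiff 𝓘(ℝ, EG) 𝓘(ℝ, EG).tangent ∞
      (fun g => (⟨g, W g⟩ : TangentBundle 𝓘(ℝ, EG) G)))
    (hK : ∀ x, 𝒢.toFiber x (W (𝒢.unit x)) ∈ 𝒢.kernel F x) :
    𝒢.IsContrast (lieD W F) where
  contMDiff := contMDiff_lieD hW hF.contMDiff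
  apply_unit x := by
    rw [LieGroupoid.lieD, hF.mfderiv_unit]
    rfl
  mfderiv_unit x := by
    ext v
    -- Only the inner field has to be smooth, so the outer one may be the constant `v` of the model
    -- space.
    have h := lieD_lieD hF.contMDiff (𝒢.unit x) (hF.mfderiv_unit x) (fun _ => v) W hW
    refine h.trans ?_
    rw [hess_symm hF.contMDiff, ← 𝒢.metric_toFiber hF]
    exact DFunLike.congr_fun (LinearMap.mem_ker.1 (hK x)) (𝒢.toFiber x v)

theorem contMDiff_mlieBracket [CompleteSpace EG] {V W : ∀ g : G, TangentSpace 𝓘(ℝ, EG) g}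
    (hV : ContMDiff 𝓘(ℝ, EG) 𝓘(ℝ, EG).tangent ∞
      (fun g => (⟨g, V g⟩ : TangentBundle 𝓘(ℝ, EG) G)))
    (hW : ContMDiff 𝓘(ℝ, EG) 𝓘(ℝ, EG).tangent ∞
      (fun g => (⟨g, W g⟩ : TangentBundle 𝓘(ℝ, EG) G))) :
    ContMDiff 𝓘(ℝ, EG) 𝓘(ℝ, EG).tangent ∞
      (fun g => (⟨g, mlieBracket 𝓘(ℝ, EG) V W g⟩ : TangentBundle 𝓘(ℝ, EG) G)) := by
  have : IsManifold 𝓘(ℝ, EG) ((⊤ : ℕ∞) + 1) G := by simpa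
  have : IsManifold 𝓘(ℝ, EG) (minSmoothness ℝ 2) G := by
    rw [minSmoothness_of_isRCLikeNormedField]
    infer_instance
  exact ContDiff.mlieBracket_vectorField (m := ⊤) (n := ⊤) hV hW (by simp)

variable [IsManifold 𝓘(ℝ, EM) ∞ M]

theorem isSection_bracket [CompleteSpace EG] {X Y : ∀ x, 𝒢.Fiber x} (hX : 𝒢.IsSection X)
    (hY : 𝒢.IsSection Y) : 𝒢.IsSection (𝒢.bracket X Y) :=
  ⟨fun x => mlieBracket 𝓘(ℝ, EG) (𝒢.leftField X) (𝒢.leftField Y) (𝒢.unit x),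
    ((contMDiff_mlieBracket (𝒢.contMDiff_leftField hX) (𝒢.contMDiff_leftField hY)).comp
      𝒢.contMDiff_unit).contMDiffOn, fun _ _ => rfl⟩

/-- Every element of `Lie(G)` is the value of a section. -/
theorem exists_isSection_eq [T2Space M] [FiniteDimensional ℝ EM] (x : M) (z : 𝒢.Fiber x) :
    ∃ Z, 𝒢.IsSection Z ∧ Z x = z := by
  set e := trivializationAt EG (TangentSpace 𝓘(ℝ, EG)) (𝒢.unit x) with he
  have hx : 𝒢.unit x ∈ e.baseSet := FiberBundle.mem_baseSet_trivializationAt' _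
  have hopen : IsOpen (𝒢.unit ⁻¹' e.baseSet) := e.open_baseSet.preimage 𝒢.contMDiff_unit.continuous
  obtain ⟨χ, -, hχ⟩ := (SmoothBumpFunction.nhds_basis_tsupport (I := 𝓘(ℝ, EM)) x).mem_iff.1
    (hopen.mem_nhds hx)
  obtain ⟨v, hv⟩ : ∃ v : EG, v = (e ⟨𝒢.unit x, 𝒢.leftRep x z⟩).2 := ⟨_, rfl⟩
  -- Constant extension in a trivialization, cut off by a bump function supported over its base set.
  set V : ∀ y, TangentSpace 𝓘(ℝ, EG) (𝒢.unit y) := fun y => χ y • e.symm (𝒢.unit y) v with hV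
  refine ⟨fun y => 𝒢.toFiber y (V y), ⟨V, fun y _ => ?_, fun _ _ => rfl⟩, ?_⟩
  · by_cases hy : 𝒢.unit y ∈ e.baseSet
    · refine contMDiffWithinAt_smul (χ.contMDiff y).contMDiffWithinAt
        (ContMDiffAt.contMDiffWithinAt ?_)
      refine (e.contMDiffAt_iff (e.mem_source.2 hy)).2 ⟨𝒢.contMDiff_unit y, ?_⟩
      refine (contMDiffAt_const (c := v)).congr_of_eventuallyEq ?_
      filter_upwards [hopen.mem_nhds hy] with w hw
      exact congrArg Prod.snd (e.apply_mk_symm hw v)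
    · have hy' : y ∉ tsupport χ := fun h => hy (hχ h)
      refine ContMDiffAt.contMDiffWithinAt ?_
      refine ((contMDiffWithinAt_zero (s := Set.univ)
        (𝒢.contMDiff_unit y).contMDiffWithinAt).contMDiffAt
        Filter.univ_mem).congr_of_eventuallyEq ?_
      filter_upwards [(isClosed_tsupport _).isOpen_compl.mem_nhds hy'] with w hw
      refine mk_congr rfl ?_
      have : χ w = 0 := image_eq_zero_of_notMem_tsupport hw
      simp [hV, this]
  · have h : V x = 𝒢.leftRep x z := by
      simp only [hV, χ.eq_one, one_smul, hv]
      exact e.symm_apply_apply_mk hx _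
    exact (congrArg (𝒢.toFiber x) h).trans (𝒢.toFiber_leftRep x z)

theorem bracket_mem_kernel [T2Space M] [FiniteDimensional ℝ EM] [CompleteSpace EG] {F : G → ℝ}
    (hF : 𝒢.IsKoszul F) {X Y : ∀ x, 𝒢.Fiber x} (hX : 𝒢.IsSectionOf (𝒢.kernel F) X)
    (hY : 𝒢.IsSectionOf (𝒢.kernel F) Y) (x : M) : 𝒢.bracket X Y x ∈ 𝒢.kernel F x := by
  have hC : 𝒢.IsContrast F := hF.toIsContrast
  have contrast {W} (hW : 𝒢.IsSectionOf (𝒢.kernel F) W) :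
      𝒢.IsContrast (lieD (𝒢.leftField W) F) :=
    hC.lieD 𝒢 (𝒢.contMDiff_leftField hW.1) fun y => by
      rw [toFiber_leftField_unit]
      exact hW.2 y
  refine LinearMap.mem_ker.2 (LinearMap.ext fun z => ?_)
  obtain ⟨Z, hZ, rfl⟩ := 𝒢.exists_isSection_eq x z
  -- W^L F is a contrast function, so V^L may be exchanged for V^R, which has the same class along
  -- M; this gives the shape of the second Koszul condition.
  have vanish {V W} (hV : 𝒢.IsSection V) (hW : 𝒢.IsSectionOf (𝒢.kernel F) W) :
      lieD (𝒢.rightField Z) (lieD (𝒢.leftField V) (lieD (𝒢.leftField W) F)) (𝒢.unit x) = 0 := by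
    rw [← 𝒢.metric_eq (contrast hW) _ _ (𝒢.contMDiff_leftField hV), toFiber_leftField_unit,
      ← 𝒢.toFiber_rightField_unit V, 𝒢.metric_eq (contrast hW) _ _ (𝒢.contMDiff_rightField hV)]
    exact hF.right Z V W hZ hV hW x
  have hB := contMDiff_mlieBracket (𝒢.contMDiff_leftField hX.1) (𝒢.contMDiff_leftField hY.1)
  -- Symmetry moves the bracket to the inner slot, where it acts directly on `F` as a commutator,
  -- with Z^R outermost as in `vanish`.
  rw [𝒢.metric_symm hC, bracket, ← 𝒢.toFiber_rightField_unit Z, 𝒢.metric_eq hC _ _ hB]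
  have hcomm : lieD (mlieBracket 𝓘(ℝ, EG) (𝒢.leftField X) (𝒢.leftField Y)) F = fun g =>
      lieD (𝒢.leftField X) (lieD (𝒢.leftField Y) F) g -
        lieD (𝒢.leftField Y) (lieD (𝒢.leftField X) F) g :=
    funext (lieD_mlieBracket hC.contMDiff (𝒢.contMDiff_leftField hX.1)
      (𝒢.contMDiff_leftField hY.1))
  rw [hcomm, lieD_sub _ (contMDiff_lieD (𝒢.contMDiff_leftField hX.1) (contrast hY).contMDiff)
    (contMDiff_lieD (𝒢.contMDiff_leftField hY.1) (contrast hX).contMDiff), vanish hX.1 hY,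
    vanish hY.1 hX, sub_zero]
  rfl

end LieGroupoid

/-! ### Smooth bases of kernels of constant dimension -/

namespace TangentField

open Module

/-- A basis of the kernel of `A`, depending smoothly on `A` among the linear maps whose kernels have
a given dimension. -/
theorem exists_contDiffOn_basis_ker {E E' : Type*} [NormedAddCommGroup E] [NormedSpace ℝ E]
    [FiniteDimensional ℝ E] [NormedAddCommGroup E'] [NormedSpace ℝ E'] [FiniteDimensional ℝ E']
    (A₀ : E →L[ℝ] E') {k : ℕ} (hk : finrank ℝ (LinearMap.ker A₀.toLinearMap) = k) :
    ∃ (e : Fin k → (E →L[ℝ] E') → E) (O : Set (E →L[ℝ] E')), IsOpen O ∧ A₀ ∈ O ∧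
      (∀ i, ContDiffOn ℝ ∞ (e i) O) ∧
      ∀ A ∈ O, finrank ℝ (LinearMap.ker A.toLinearMap) = k →
        LinearIndependent ℝ (fun i => e i A) ∧
          Submodule.span ℝ (Set.range fun i => e i A) = LinearMap.ker A.toLinearMap := by
  have : CompleteSpace E := FiniteDimensional.complete ℝ E
  set K := LinearMap.ker A₀.toLinearMap with hK
  set R := LinearMap.range A₀.toLinearMap with hR
  obtain ⟨q, hq⟩ := Submodule.ClosedComplemented.of_finiteDimensional K
  obtain ⟨P, hP⟩ := Submodule.ClosedComplemented.of_finiteDimensional R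
  have hdim : finrank ℝ R + k = finrank ℝ E := hk ▸ LinearMap.finrank_range_add_finrank_ker _
  -- `P` and `q` project onto the range and the kernel of `A₀`, so `T A₀` is an isomorphism, and `T
  -- A` stays one for `A` nearby.
  set T : (E →L[ℝ] E') → E →L[ℝ] (R × K) := fun A => (P.comp A).prod q with hT
  have hTs : ContDiff ℝ ∞ T := by
    have : T = fun A => (ContinuousLinearMap.inl ℝ R K).comp (P.comp A) +
        (ContinuousLinearMap.inr ℝ R K).comp q := by
      ext A v <;> simp [T]
    rw [this]
    fun_prop
  have hinj : Function.Injective (T A₀) := by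
    rw [← ContinuousLinearMap.coe_coe, ← LinearMap.ker_eq_bot, LinearMap.ker_eq_bot']
    intro v hv
    have h1 : P (A₀ v) = 0 := congrArg Prod.fst hv
    have h2 : q v = 0 := congrArg Prod.snd hv
    have h3 := hP ⟨A₀ v, v, rfl⟩
    have h4 : A₀ v = 0 := congrArg Subtype.val (h3.symm.trans h1)
    exact congrArg Subtype.val ((hq ⟨v, h4⟩).symm.trans h2)
  have hfin : finrank ℝ E = finrank ℝ (R × K) := by
    rw [finrank_prod, hk, hdim]
  set Φ₀ := (LinearEquiv.ofInjectiveOfFinrankEq (T A₀).toLinearMap hinj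
    hfin).toContinuousLinearEquiv
  have hΦ₀ : (Φ₀ : E →L[ℝ] (R × K)) = T A₀ := by
    ext1 v
    rfl
  let β : Basis (Fin k) ℝ K := finBasisOfFinrankEq ℝ K hk
  -- The i-th vector is the solution of P (A v) = 0, q v = β i.
  refine ⟨fun i A => (T A).inverse (0, β i),
    T ⁻¹' Set.range ((↑) : (E ≃L[ℝ] (R × K)) → E →L[ℝ] (R × K)),
    (ContinuousLinearEquiv.isOpen).preimage hTs.continuous, ⟨Φ₀, hΦ₀⟩, ?_, ?_⟩
  · rintro i A ⟨Φ, hΦ⟩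
    have h1 : ContDiffAt ℝ ∞ ContinuousLinearMap.inverse (T A) := hΦ ▸ contDiffAt_map_inverse Φ
    exact ((h1.comp A hTs.contDiffAt).clm_apply contDiffAt_const).contDiffWithinAt
  · rintro A ⟨Φ, hΦ⟩ hA
    have hinv : (T A).inverse = Φ.symm := by rw [← hΦ, ContinuousLinearMap.inverse_equiv]
    have hΦ' (v) : Φ v = (P (A v), q v) := congrArg (fun B => B v) hΦ
    set B : E →ₗ[ℝ] R := P.toLinearMap.comp A.toLinearMap with hB
    have hBs : LinearMap.range B = ⊤ := by
      refine LinearMap.range_eq_top.2 fun r => ⟨Φ.symm (r, 0), ?_⟩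
      have := hΦ' (Φ.symm (r, 0))
      rw [Φ.apply_symm_apply] at this
      exact (congrArg Prod.fst this).symm
    have hBk : finrank ℝ (LinearMap.ker B) = k := by
      have := LinearMap.finrank_range_add_finrank_ker B
      rw [hBs, finrank_top] at this
      omega
    -- Here the dimension hypothesis on `A` enters: ker A lies in ker (P ∘ A), and both have
    -- dimension `k`.
    have hker : LinearMap.ker A.toLinearMap = LinearMap.ker B :=
      Submodule.eq_of_le_of_finrank_eq (LinearMap.ker_le_ker_comp _ _) (hA.trans hBk.symm)
    have hli : LinearIndependent ℝ (fun i => (T A).inverse (0, β i)) := by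
      rw [hinv]
      exact (β.linearIndependent.map' (LinearMap.inr ℝ R K)
        (LinearMap.ker_eq_bot.2 LinearMap.inr_injective)).map' Φ.symm.toLinearEquiv.toLinearMap
        Φ.symm.toLinearEquiv.ker
    refine ⟨hli, Submodule.eq_of_le_of_finrank_eq ?_ ?_⟩
    · rw [Submodule.span_le, hker]
      rintro _ ⟨i, rfl⟩
      have := hΦ' (Φ.symm (0, β i))
      rw [Φ.apply_symm_apply] at this
      simp only [hinv]
      exact (congrArg Prod.fst this).symm
    · rw [finrank_span_eq_card hli, Fintype.card_fin, hA]

end TangentField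

/-! ### The kernel as a vector subbundle -/

namespace LieGroupoid

open TangentField Bundle Module

variable {EM EG M G : Type*}
  [NormedAddCommGroup EM] [NormedSpace ℝ EM] [NormedAddCommGroup EG] [NormedSpace ℝ EG]
  [TopologicalSpace M] [ChartedSpace EM M]
  [TopologicalSpace G] [ChartedSpace EG G] (𝒢 : LieGroupoid EM EG M G)

instance finiteDimensional_fiber [FiniteDimensional ℝ EG] (x : M) :
    FiniteDimensional ℝ (𝒢.Fiber x) :=
  have : FiniteDimensional ℝ (TangentSpace 𝓘(ℝ, EG) (𝒢.unit x)) :=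
    inferInstanceAs (FiniteDimensional ℝ EG)
  inferInstance

theorem finrank_fiber_add [FiniteDimensional ℝ EG] (x : M) :
    finrank ℝ (𝒢.Fiber x) + finrank ℝ EM = finrank ℝ EG := by
  have : FiniteDimensional ℝ (TangentSpace 𝓘(ℝ, EG) (𝒢.unit x)) :=
    inferInstanceAs (FiniteDimensional ℝ EG)
  have h := Submodule.finrank_quotient_add_finrank (LinearMap.range (𝒢.dUnit x))
  rwa [LinearMap.finrank_range_of_inj
    (Function.LeftInverse.injective (g := 𝒢.dTgt x) (𝒢.dTgt_dUnit x))] at h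

variable [IsManifold 𝓘(ℝ, EG) ∞ G]

theorem IsSmoothOn.sum_smul {ι : Type*} [Fintype ι] {X : ι → ∀ x, 𝒢.Fiber x} {U : Set M}
    (hX : ∀ i, 𝒢.IsSection (X i)) {a : ι → M → ℝ}
    (ha : ∀ i, ContMDiffOn 𝓘(ℝ, EM) 𝓘(ℝ, ℝ) ∞ (a i) U) :
    𝒢.IsSmoothOn (fun x => ∑ i, a i x • X i x) U := by
  choose V hV hVX using hX
  refine ⟨fun x => ∑ i, a i x • V i x, fun x hx => ?_, fun x _ => ?_⟩
  · exact contMDiffWithinAt_sum _ (𝒢.contMDiff_unit x).contMDiffWithinAt fun i _ =>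
      contMDiffWithinAt_smul (ha i x hx) ((hV i x (Set.mem_univ x)).mono (Set.subset_univ U))
  · simp only [map_sum, map_smul, hVX _ x (Set.mem_univ x)]

variable [IsManifold 𝓘(ℝ, EM) ∞ M]

/-- Invariant extensions express the form as X^L Y^L F restricted to the units. -/
theorem contMDiff_metric {F : G → ℝ} (hF : 𝒢.IsContrast F) {X Y : ∀ x, 𝒢.Fiber x}
    (hX : 𝒢.IsSection X) (hY : 𝒢.IsSection Y) :
    ContMDiff 𝓘(ℝ, EM) 𝓘(ℝ, ℝ) ∞ fun x => 𝒢.metric F x (X x) (Y x) := by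
  have h : (fun x => 𝒢.metric F x (X x) (Y x)) =
      lieD (𝒢.leftField X) (lieD (𝒢.leftField Y) F) ∘ 𝒢.unit := funext fun x => by
    rw [Function.comp_apply, ← 𝒢.metric_eq hF _ _ (𝒢.contMDiff_leftField hY),
      toFiber_leftField_unit, toFiber_leftField_unit]
  rw [h]
  exact (contMDiff_lieD (𝒢.contMDiff_leftField hX)
    (contMDiff_lieD (𝒢.contMDiff_leftField hY) hF.contMDiff)).comp 𝒢.contMDiff_unit

/-- Left representatives read in a trivialization are continuous `EG`-valued maps near `x₀`.
Independence is open for them and passes back from images under a linear map. -/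
theorem eventually_linearIndependent {ι : Type*} [Finite ι] {X : ι → ∀ x, 𝒢.Fiber x}
    (hX : ∀ i, 𝒢.IsSection (X i)) {x₀ : M} (h₀ : LinearIndependent ℝ fun i => X i x₀) :
    ∀ᶠ x in 𝓝 x₀, LinearIndependent ℝ fun i => X i x := by
  set e := trivializationAt EG (TangentSpace 𝓘(ℝ, EG)) (𝒢.unit x₀) with he
  have hx₀ : 𝒢.unit x₀ ∈ e.baseSet := FiberBundle.mem_baseSet_trivializationAt' _
  let L (x : M) : 𝒢.Fiber x →ₗ[ℝ] EG := (e.linearMapAt ℝ (𝒢.unit x)).comp (𝒢.leftRep x)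
  have hL₀ : LinearMap.ker (L x₀) = ⊥ := by
    refine LinearMap.ker_eq_bot.2 fun a b hab => 𝒢.leftRep_injective x₀ ?_
    change e.linearMapAt ℝ (𝒢.unit x₀) _ = e.linearMapAt ℝ (𝒢.unit x₀) _ at hab
    rw [e.linearMapAt_def_of_mem hx₀] at hab
    exact (e.linearEquivAt ℝ _ hx₀).injective hab
  have hmem : ∀ᶠ x in 𝓝 x₀, 𝒢.unit x ∈ e.baseSet :=
    𝒢.contMDiff_unit.continuous.continuousAt.eventually (e.open_baseSet.mem_nhds hx₀)
  have hc : ContinuousAt (fun x i => L x (X i x)) x₀ := by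
    refine continuousAt_pi.2 fun i => ?_
    refine (contMDiffAt_totalSpace.1
      (𝒢.contMDiffAt_leftRep (hX i) x₀)).2.continuousAt.congr ?_
    filter_upwards [hmem] with x hx
    exact (congrFun (e.coe_linearMapAt_of_mem (R := ℝ) hx) _).symm
  filter_upwards [hc.eventually (isOpen_setOfPred_linearIndependent.mem_nhds (h₀.map' (L x₀) hL₀))]
    with x hx
  exact LinearIndependent.of_comp (L x) hx

/-- The kernel of a form of constant rank is a subbundle. -/
theorem isSubbundle_kernel [FiniteDimensional ℝ EM] [FiniteDimensional ℝ EG] [T2Space M]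
    {F : G → ℝ} (hF : 𝒢.IsRegular F) :
    𝒢.IsSubbundle (𝒢.kernel F) := by
  obtain ⟨r, hr⟩ := hF.constant_rank
  have hC : 𝒢.IsContrast F := hF.toIsContrast
  have hρ (x : M) : finrank ℝ (𝒢.kernel F x) = finrank ℝ EG - finrank ℝ EM - r := by
    have h1 := LinearMap.finrank_range_add_finrank_ker (𝒢.metric F x)
    have h2 := 𝒢.finrank_fiber_add x
    rw [hr x] at h1
    change finrank ℝ (LinearMap.ker (𝒢.metric F x)) = _
    omega
  refine ⟨finrank ℝ EG - finrank ℝ EM - r, fun x₀ => ?_⟩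
  set m := finrank ℝ (𝒢.Fiber x₀) with hm
  have hdim (x : M) : m = finrank ℝ (𝒢.Fiber x) :=
    Nat.add_right_cancel ((𝒢.finrank_fiber_add x₀).trans (𝒢.finrank_fiber_add x).symm)
  let b : Basis (Fin m) ℝ (𝒢.Fiber x₀) := finBasisOfFinrankEq ℝ _ rfl
  choose X hX hXb using fun i => 𝒢.exists_isSection_eq x₀ (b i)
  obtain ⟨W, hW, hWo, hxW⟩ := mem_nhds_iff.1 (𝒢.eventually_linearIndependent hX (x₀ := x₀)
    (by simpa only [hXb] using b.linearIndependent))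
  -- The Gram matrix of g^F in the sections `X`; where these form a frame, its kernel is the
  -- coordinate form of K^F.
  let A (x : M) : (Fin m → ℝ) →L[ℝ] (Fin m → ℝ) := ∑ i, ∑ j, 𝒢.metric F x (X i x) (X j x) •
    (ContinuousLinearMap.proj i : (Fin m → ℝ) →L[ℝ] ℝ).smulRight (Pi.single j 1 : Fin m → ℝ)
  have hAs : ContMDiff 𝓘(ℝ, EM) 𝓘(ℝ, (Fin m → ℝ) →L[ℝ] (Fin m → ℝ)) ∞ A :=
    contMDiff_finsetSum fun i _ => contMDiff_finsetSum fun j _ =>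
      (𝒢.contMDiff_metric hC (hX i) (hX j)).smul contMDiff_const
  have hA (x : M) (v : Fin m → ℝ) (j : Fin m) :
      A x v j = 𝒢.metric F x (∑ i, v i • X i x) (X j x) := by
    simp [A, Finset.sum_apply, Pi.single_apply, mul_comm]
  have hker (x : M) (hx : x ∈ W) : ∃ Φ : (Fin m → ℝ) ≃ₗ[ℝ] 𝒢.Fiber x,
      (∀ v, Φ v = ∑ i, v i • X i x) ∧
      (LinearMap.ker (A x).toLinearMap).map Φ.toLinearMap = 𝒢.kernel F x := by
    let B := basisOfLinearIndependentOfCardEqFinrank' _ (hW hx) ((Fintype.card_fin m).trans (hdim x))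
    have hB (i) : B i = X i x := by simp [B]
    have hΦ (v : Fin m → ℝ) : B.equivFun.symm v = ∑ i, v i • X i x := by
      simp [Basis.equivFun_symm_apply, hB]
    refine ⟨B.equivFun.symm, hΦ, ?_⟩
    ext z
    obtain ⟨v, rfl⟩ := B.equivFun.symm.surjective z
    rw [Submodule.mem_map_equiv, LinearEquiv.symm_apply_apply]
    change A x v = 0 ↔ 𝒢.metric F x (B.equivFun.symm v) = 0
    rw [hΦ]
    constructor
    · intro h
      refine B.ext fun j => ?_
      rw [hB, ← hA, h]
      rfl
    · intro h
      ext j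
      rw [hA, h]
      rfl
  have hk (x : M) (hx : x ∈ W) : finrank ℝ (LinearMap.ker (A x).toLinearMap) =
      finrank ℝ EG - finrank ℝ EM - r := by
    obtain ⟨Φ, -, hΦ⟩ := hker x hx
    rw [← hρ x, ← hΦ]
    exact (Φ.finrank_map_eq _).symm
  obtain ⟨e, O, hO, hAO, hes, he⟩ := exists_contDiffOn_basis_ker (A x₀) (hk x₀ hxW)
  refine ⟨W ∩ A ⁻¹' O, hWo.inter (hO.preimage hAs.continuous), ⟨hxW, hAO⟩,
    fun i x => ∑ j, e i (A x) j • X j x, fun i => ?_, fun x hx => ?_⟩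
  · refine IsSmoothOn.sum_smul 𝒢 hX fun j => ?_
    have h1 : ContMDiffOn 𝓘(ℝ, EM) 𝓘(ℝ, Fin m → ℝ) ∞ (fun x => e i (A x)) (W ∩ A ⁻¹' O) :=
      (hes i).contMDiffOn.comp hAs.contMDiffOn fun x hx => hx.2
    exact contMDiffOn_pi_space.1 h1 j
  · obtain ⟨Φ, hΦ, hΦk⟩ := hker x hx.1
    obtain ⟨hli, hspan⟩ := he (A x) hx.2 (hk x hx.1)
    simp only [← hΦ]
    refine ⟨hli.map' Φ.toLinearMap Φ.ker, ?_⟩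
    rw [← hΦk, ← hspan, Submodule.map_span, ← Set.range_comp]
    rfl

end LieGroupoid

end

theorem mainTheorem5 {EM EG M G : Type*}
    [NormedAddCommGroup EM] [NormedSpace ℝ EM] [FiniteDimensional ℝ EM]
    [NormedAddCommGroup EG] [NormedSpace ℝ EG] [FiniteDimensional ℝ EG]
    [TopologicalSpace M] [ChartedSpace EM M] [IsManifold 𝓘(ℝ, EM) ∞ M] [T2Space M]
    [TopologicalSpace G] [ChartedSpace EG G] [IsManifold 𝓘(ℝ, EG) ∞ G]
    (𝒢 : LieGroupoid EM EG M G) (F : G → ℝ) (hF : 𝒢.IsKoszul F) :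
    (∀ X Y, 𝒢.IsSectionOf (𝒢.kernel F) X → 𝒢.IsSectionOf (𝒢.kernel F) Y →
      𝒢.IsSectionOf (𝒢.kernel F) (𝒢.bracket X Y)) ∧
    𝒢.IsLieSubalgebroid (𝒢.kernel F) := by
  have : CompleteSpace EG := FiniteDimensional.complete ℝ EG
  have h : ∀ X Y, 𝒢.IsSectionOf (𝒢.kernel F) X → 𝒢.IsSectionOf (𝒢.kernel F) Y →
      𝒢.IsSectionOf (𝒢.kernel F) (𝒢.bracket X Y) := fun X Y hX hY =>
    ⟨𝒢.isSection_bracket hX.1 hY.1, 𝒢.bracket_mem_kernel hF hX hY⟩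
  exact ⟨h, 𝒢.isSubbundle_kernel hF.toIsRegular, h⟩
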